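/- Let $n\ge 0$ be an integer. The set of all real $n\times n$ matrices with purely imaginary spectrum (i.e. all of whose complex eigenvalues have real part $0$, the eigenvalue $0$ being allowed) is the disjoint union of finitely many non-empty sets $M_1,\dots,M_k$, each of which is an embedded $C^\infty$ submanifold of $\mathrm{Mat}(\mathbb{R},n)\cong\mathbb{R}^{n^2}$ (of constant dimension, not necessarily connected) and is conjugacy invariant: if $A\in M_i$ and $C\in \mathrm{GL}(\mathbb{R},n)$, then $CAC^{-1}\in M_i$. Exactly one of these submanifolds has real dimension $n^2-\lceil n/2\rceil$, and all the others have strictly smaller dimension. The one of dimension $n^2-\lceil n/2\rceil$ consists of exactly those real $n\times n$ matrices with purely imaginary spectrum whose $n$ complex eigenvalues, counted with algebraic multiplicity, are pairwise distinct. -/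

import Mathlib

open scoped ContDiff Matrix.Norms.Elementwise

/-- `M` is an embedded `C^∞` submanifold of dimension `d` of the finite-dimensional real vector
space `E`: around each point of `M` there is a smooth chart of `E` (a diffeomorphism `φ` between
open subsets of `E`) that maps the part of `M` in its domain onto the part of a `d`-dimensional
linear subspace in its range. The dimension is `d` at every point. -/
def IsEmbeddedSubmanifold {E : Type*} [NormedAddCommGroup E] [NormedSpace ℝ E]
    [FiniteDimensional ℝ E] (d : ℕ) (M : Set E) : Prop :=
  ∀ x ∈ M, ∃ φ : OpenPartialHomeomorph E E,
    x ∈ φ.source ∧ ContDiffOn ℝ ∞ φ φ.source ∧ ContDiffOn ℝ ∞ φ.symm φ.target ∧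
    ∃ V : Submodule ℝ E, Module.finrank ℝ V = d ∧ φ '' (φ.source ∩ M) = φ.target ∩ (V : Set E)

/-- The real matrix `A`, regarded as a complex matrix. -/
noncomputable def complexify {n : ℕ} (A : Matrix (Fin n) (Fin n) ℝ) :
    Matrix (Fin n) (Fin n) ℂ :=
  A.map (algebraMap ℝ ℂ)

/-- All complex eigenvalues of the real matrix `A` lie on the imaginary axis (`0` included). -/
def HasPurelyImaginarySpectrum {n : ℕ} (A : Matrix (Fin n) (Fin n) ℝ) : Prop :=
  ∀ z ∈ spectrum ℂ (complexify A), z.re = 0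

/-- The complex eigenvalues of the real matrix `A`, counted with algebraic multiplicity,
are pairwise distinct. -/
def HasNoRepeatedEigenvalues {n : ℕ} (A : Matrix (Fin n) (Fin n) ℝ) : Prop :=
  (complexify A).charpoly.roots.Nodup

/-- `M` is invariant under conjugation by invertible real matrices. -/
def IsConjugacyInvariant {n : ℕ} (M : Set (Matrix (Fin n) (Fin n) ℝ)) : Prop :=
  ∀ A ∈ M, ∀ C : (Matrix (Fin n) (Fin n) ℝ)ˣ,
    (C : Matrix (Fin n) (Fin n) ℝ) * A * (C⁻¹ : (Matrix (Fin n) (Fin n) ℝ)ˣ).val ∈ M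

/-! A matrix with purely imaginary spectrum has a Jordan–Chevalley decomposition `A = S + N` with `S
= ∑ θ j • J j`, where `0 < θ 0 < θ 1 < …` are the frequencies and `J j` is a complex structure on
the real generalized eigenspace of `± i θ j`, extended by zero (so `-J j ^ 2` is the projection onto
it). The pair `(J, N)` is a frame. Letting the frequencies vary in the open cone of increasing
positive tuples and conjugating gives the stratum of the frame: the matrices of one Jordan type,
where the order of the frequencies is part of the type.

Strata cover everything (`exists_frame_of_hasPurelyImaginarySpectrum`). They are equal or disjoint,
because an element determines its frequencies and then its frame (`exists_eq_of_mem_stratum`). There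
are finitely many: each contains an element with frequencies `1, …, m`, all these elements are
killed by one polynomial depending on `n` only, and such matrices form finitely many conjugacy
classes, as follows from the structure of torsion `ℝ[X]`-modules
(`exists_finite_conj_representatives`).

A stratum is a submanifold because the centralizer of a point depends on the frame and not on the
frequencies (`centralizer_point`). Conjugating by `1 + X`, with `X` in a complement of the
centralizer, and shifting the frequencies gives an immersion (`eq_zero_of_semis_eq_bracket`). It is
locally onto the stratum since nearby elements have nearby frequencies (`eventually_abs_sub_lt`) and
conjugators that can be moved close to `1` (`exists_conj_near_one`). The dimension is therefore `n ^
2 - z + m`, with `z` the dimension of the centralizer.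

Finally `z ≥ n` and `2 * m ≤ n` bound the dimension by `n ^ 2 - n + n / 2`. Equality forces `n ≤ 2 *
m + 1`, which is simplicity of the spectrum. Then the matrix is cyclic, so `z = n`, and cyclic
matrices with the same minimal polynomial are conjugate, so only one stratum qualifies. -/

open Polynomial

/-! ### Jordan–Chevalley decomposition inside an algebra -/

section CommutingElements

universe u v

variable {R : Type u} {𝔸 : Type v} [Field R] [Ring 𝔸] [Algebra R 𝔸]

open scoped IsMulCommutative in
/-- A set of pairwise commuting elements of an algebra lies in the range of an injective
homomorphism from a commutative algebra. -/
theorem exists_commRing_hom_of_commute {s : Set 𝔸} (h : ∀ x ∈ s, ∀ y ∈ s, x * y = y * x) :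
    ∃ (B : Type v) (_ : CommRing B) (_ : Algebra R B) (φ : B →ₐ[R] 𝔸),
      Function.Injective φ ∧ φ.range = Algebra.adjoin R s := by
  have := Algebra.isMulCommutative_adjoin R h
  exact ⟨Algebra.adjoin R s, inferInstance, inferInstance, (Algebra.adjoin R s).val,
    Subtype.val_injective, Subalgebra.range_val _⟩

theorem Commute.exists_commRing_hom {x y : 𝔸} (h : Commute x y) :
    ∃ (B : Type v) (_ : CommRing B) (_ : Algebra R B) (φ : B →ₐ[R] 𝔸),
      Function.Injective φ ∧ (∃ x', φ x' = x) ∧ ∃ y', φ y' = y := by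
  obtain ⟨B, _, _, φ, hφ, hr⟩ := exists_commRing_hom_of_commute (R := R) (s := {x, y}) (by
    rintro a (rfl | rfl) b (rfl | rfl)
    exacts [rfl, h, h.symm, rfl])
  refine ⟨B, _, _, φ, hφ, ?_, ?_⟩
  all_goals
    rw [← AlgHom.mem_range, hr]
    exact Algebra.subset_adjoin (by simp)

theorem isNilpotent_aeval_add_of_commute {S N : 𝔸} (h : Commute S N) (hN : IsNilpotent N)
    {f : R[X]} (hf : aeval S f = 0) : IsNilpotent (aeval (S + N) f) := by
  obtain ⟨B, _, _, φ, hφ, ⟨S, rfl⟩, ⟨N, rfl⟩⟩ := h.exists_commRing_hom (R := R)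
  rw [IsNilpotent.map_iff hφ] at hN
  have h2 := (isNilpotent_aeval_sub_of_isNilpotent_sub f (a := S + N) (b := S) (by simpa)).map φ
  rwa [map_sub, ← aeval_algHom_apply, ← aeval_algHom_apply, hf, sub_zero, map_add] at h2

theorem isUnit_aeval_of_isCoprime {A : 𝔸} {f g : R[X]} (hf : IsNilpotent (aeval A f))
    (h : IsCoprime f g) : IsUnit (aeval A g) := by
  obtain ⟨a, b, hab⟩ := h
  have h1 : aeval A a * aeval A f + aeval A b * aeval A g = 1 := by
    rw [← map_mul, ← map_mul, ← map_add, hab, map_one]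
  have h2 : IsUnit (aeval A b * aeval A g) := by
    rw [← eq_sub_iff_add_eq'] at h1
    rw [h1]
    exact (((commute_aeval A).isNilpotent_mul_left hf)).isUnit_one_sub
  exact ((commute_aeval A).isUnit_mul_iff.1 h2).2
where
  commute_aeval (A : 𝔸) {p q : R[X]} : Commute (aeval A p) (aeval A q) := by
    rw [Commute, SemiconjBy, ← map_mul, ← map_mul, mul_comm]

/-- Jordan–Chevalley: inside the commutative algebra generated by `A`, the nilpotency of `f(A)` and
the invertibility of `f'(A)`, which separability provides, allow `A` to be corrected by a nilpotent
to an exact root of `f`. -/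
theorem exists_mem_adjoin_isNilpotent_sub {A : 𝔸} {f : R[X]} (hf : IsNilpotent (aeval A f))
    (hs : f.Separable) :
    ∃ S ∈ Algebra.adjoin R {A}, IsNilpotent (A - S) ∧ aeval S f = 0 := by
  obtain ⟨B, _, _, φ, hφ, hr⟩ := exists_commRing_hom_of_commute (R := R) (s := {A}) (by simp)
  obtain ⟨A, rfl⟩ : ∃ A', φ A' = A := by
    rw [← AlgHom.mem_range, hr]
    exact Algebra.self_mem_adjoin_singleton R A
  rw [aeval_algHom_apply, IsNilpotent.map_iff hφ] at hf
  obtain ⟨r, ⟨hn, hz⟩, -⟩ := existsUnique_nilpotent_sub_and_aeval_eq_zero hf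
    (isUnit_aeval_of_isCoprime hf hs)
  refine ⟨φ r, hr ▸ ⟨r, rfl⟩, ?_, ?_⟩
  · rw [← map_sub]; exact hn.map φ
  · rw [aeval_algHom_apply, hz, map_zero]

theorem eq_of_commute_of_isNilpotent_sub {x y : 𝔸} (h : Commute x y) {f : R[X]}
    (hx : aeval x f = 0) (hy : aeval y f = 0) (hs : f.Separable) (hn : IsNilpotent (x - y)) :
    x = y := by
  obtain ⟨B, _, _, φ, hφ, ⟨x, rfl⟩, ⟨y, rfl⟩⟩ := h.exists_commRing_hom (R := R)
  rw [aeval_algHom_apply, map_eq_zero_iff φ hφ] at hx hy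
  rw [← map_sub, IsNilpotent.map_iff hφ] at hn
  have h1 : IsNilpotent (aeval x f) := by rw [hx]; exact IsNilpotent.zero
  exact congrArg φ ((existsUnique_nilpotent_sub_and_aeval_eq_zero h1
    (isUnit_aeval_of_isCoprime h1 hs)).unique (y₁ := x) (y₂ := y) ⟨by simp, hx⟩ ⟨hn, hy⟩)

theorem aeval_mul_of_mul_eq_smul {a x : 𝔸} {c : R} (h : a * x = c • x) (p : R[X]) :
    aeval a p * x = p.eval c • x := by
  induction p using Polynomial.induction_on' with
  | add p q hp hq => rw [map_add, add_mul, hp, hq, eval_add, add_smul]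
  | monomial k b =>
    have hk : a ^ k * x = c ^ k • x := by
      induction k with
      | zero => simp
      | succ k ih => rw [pow_succ, mul_assoc, h, mul_smul_comm, ih, smul_smul, pow_succ']
    rw [aeval_monomial, eval_monomial, mul_assoc, hk, ← Algebra.smul_def, smul_smul]

end CommutingElements

/-! ### The polynomial killing the semisimple part -/

/-- The polynomial with roots `0` and `± i θ j`. -/
noncomputable def imagPoly {m : ℕ} (θ : Fin m → ℝ) : ℝ[X] :=
  (Lagrange.nodal Finset.univ fun j => -(θ j) ^ 2).comp (X ^ 2) * X

/-- Bézout identities survive the substitution `X ↦ X ^ 2`, which reduces the first factor to `q`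
having no root at `-w ^ 2`; the factor `X` has an explicit identity. -/
theorem isCoprime_comp_sq_mul_X {q : ℝ[X]} {w : ℝ} (hw : w ≠ 0) (hq : q.eval (-w ^ 2) ≠ 0) :
    IsCoprime (q.comp (X ^ 2) * X) (X ^ 2 + C (w ^ 2)) := by
  refine IsCoprime.mul_left ?_ ⟨-C (w ^ 2)⁻¹ * X, C (w ^ 2)⁻¹, ?_⟩
  · have h1 : IsCoprime q (X - C (-w ^ 2)) := by
      refine IsCoprime.symm ((irreducible_X_sub_C _).coprime_iff_not_dvd.2 ?_)
      rwa [dvd_iff_isRoot]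
    simpa using h1.map (compRingHom (X ^ 2))
  · have : C (w ^ 2)⁻¹ * C (w ^ 2) = (1 : ℝ[X]) := by
      rw [← C_mul, inv_mul_cancel₀ (pow_ne_zero 2 hw), C_1]
    linear_combination this

section ImagPoly

variable {m : ℕ} {θ : Fin m → ℝ}

theorem neg_sq_injective (hθ : StrictMono θ) (h0 : ∀ j, 0 < θ j) :
    Function.Injective fun j => -(θ j) ^ 2 := by
  intro i j hij
  have h1 : (θ i) ^ 2 = (θ j) ^ 2 := by simpa using hij
  exact hθ.injective ((pow_left_inj₀ (h0 i).le (h0 j).le two_ne_zero).1 h1)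

theorem imagPoly_eq_prod : imagPoly θ = (∏ j, (X ^ 2 + C (θ j ^ 2))) * X := by
  simp [imagPoly, Lagrange.nodal, Polynomial.prod_comp]

theorem aeval_imagPoly {𝔸 : Type*} [Ring 𝔸] [Algebra ℝ 𝔸] (S : 𝔸) :
    aeval S (imagPoly θ) =
      aeval (S ^ 2) (Lagrange.nodal Finset.univ fun j => -(θ j) ^ 2) * S := by
  simp [imagPoly, aeval_comp]

theorem pairwise_isCoprime_sq_add (hθ : StrictMono θ) (h0 : ∀ j, 0 < θ j) :
    Pairwise (Function.onFun IsCoprime fun j => (X ^ 2 + C (θ j ^ 2) : ℝ[X])) := by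
  intro i j hij
  have h1 : θ i ^ 2 - θ j ^ 2 ≠ 0 := by
    intro h
    exact hij (neg_sq_injective hθ h0 (by simpa using sub_eq_zero.1 h))
  refine ⟨C (θ i ^ 2 - θ j ^ 2)⁻¹, -C (θ i ^ 2 - θ j ^ 2)⁻¹, ?_⟩
  have : C (θ i ^ 2 - θ j ^ 2)⁻¹ * C (θ i ^ 2 - θ j ^ 2) = (1 : ℝ[X]) := by
    rw [← C_mul, inv_mul_cancel₀ h1, C_1]
  rw [C_sub] at this
  linear_combination this

theorem isCoprime_prod_sq_add_X (h0 : ∀ j, 0 < θ j) :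
    IsCoprime (∏ j, (X ^ 2 + C (θ j ^ 2) : ℝ[X])) X := by
  have h1 := (irreducible_X_sub_C (0 : ℝ)).coprime_iff_not_dvd
    (n := ∏ j, (X ^ 2 + C (θ j ^ 2) : ℝ[X]))
  rw [dvd_iff_isRoot, C_0, sub_zero] at h1
  refine (h1.2 ?_).symm
  simp only [IsRoot, eval_prod, Finset.prod_eq_zero_iff, not_exists, not_and]
  intro j _
  simpa using (h0 j).ne'

theorem imagPoly_separable (hθ : StrictMono θ) (h0 : ∀ j, 0 < θ j) : (imagPoly θ).Separable := by
  rw [imagPoly_eq_prod]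
  refine Separable.mul (separable_prod (pairwise_isCoprime_sq_add hθ h0) fun j => ?_) separable_X
    (isCoprime_prod_sq_add_X h0)
  have h1 : X ^ 2 + C (θ j ^ 2) = X ^ 2 - C (-(θ j) ^ 2) := by simp
  rw [h1]
  exact separable_X_pow_sub_C _ (by norm_num) (by simpa using (h0 j).ne')

end ImagPoly

/-! ### Frames and their strata -/

/-- The data of the Jordan type of an element with purely imaginary spectrum: a complex structure
`J j` on each of the real generalized eigenspaces with nonzero eigenvalue, and a nilpotent part. -/
structure ImagFrame (𝔸 : Type*) [Ring 𝔸] [Algebra ℝ 𝔸] (m : ℕ) where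
  /-- The complex structures. -/
  J : Fin m → 𝔸
  /-- The nilpotent part. -/
  N : 𝔸
  J_mul_J : ∀ i j, i ≠ j → J i * J j = 0
  cube : ∀ j, J j ^ 3 = -J j
  ne_zero : ∀ j, J j ≠ 0
  comm : ∀ j, Commute N (J j)
  nilp : IsNilpotent N

namespace ImagFrame

variable {𝔸 : Type*} [Ring 𝔸] [Algebra ℝ 𝔸] {m : ℕ} (fr : ImagFrame 𝔸 m)

/-- The semisimple element with eigenvalues `± i θ j` attached to a frame. -/
def semis (θ : Fin m → ℝ) : 𝔸 := ∑ j, θ j • fr.J j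

/-- The element with eigenvalues `± i θ j` attached to a frame. -/
def point (θ : Fin m → ℝ) : 𝔸 := fr.semis θ + fr.N

/-- All conjugates of all the elements attached to a frame. -/
def stratum : Set 𝔸 :=
  {A | ∃ θ : Fin m → ℝ, StrictMono θ ∧ (∀ j, 0 < θ j) ∧
    ∃ C : 𝔸ˣ, A = C * fr.point θ * (C⁻¹ : 𝔸ˣ)}

variable {fr}

@[ext] theorem ext' {fr' : ImagFrame 𝔸 m} (hJ : fr.J = fr'.J) (hN : fr.N = fr'.N) : fr = fr' := by
  cases fr; cases fr'; simp_all

variable (fr)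

theorem commute_N_semis (θ : Fin m → ℝ) : Commute fr.N (fr.semis θ) :=
  Commute.sum_right _ _ _ fun j _ => (fr.comm j).smul_right _

theorem semis_mul_J (θ : Fin m → ℝ) (j : Fin m) : fr.semis θ * fr.J j = θ j • fr.J j ^ 2 := by
  rw [semis, Finset.sum_mul, Finset.sum_eq_single j]
  · rw [smul_mul_assoc, sq]
  · intro i _ hij
    rw [smul_mul_assoc, fr.J_mul_J i j hij, smul_zero]
  · simp

theorem J_mul_semis (θ : Fin m → ℝ) (j : Fin m) : fr.J j * fr.semis θ = θ j • fr.J j ^ 2 := by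
  rw [semis, Finset.mul_sum, Finset.sum_eq_single j]
  · rw [mul_smul_comm, sq]
  · intro i _ hij
    rw [mul_smul_comm, fr.J_mul_J j i hij.symm, smul_zero]
  · simp

theorem semis_sq_mul_J (θ : Fin m → ℝ) (j : Fin m) :
    fr.semis θ ^ 2 * fr.J j = (-(θ j) ^ 2) • fr.J j := by
  rw [sq, mul_assoc, semis_mul_J, mul_smul_comm, sq (fr.J j), ← mul_assoc, semis_mul_J,
    smul_mul_assoc, ← pow_succ, fr.cube, smul_smul, smul_neg, neg_smul, sq]

theorem aeval_semis_sq_mul_semis (θ : Fin m → ℝ) (p : ℝ[X]) :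
    aeval (fr.semis θ ^ 2) p * fr.semis θ = ∑ k, (θ k * p.eval (-(θ k) ^ 2)) • fr.J k := by
  conv_lhs => rw [semis.eq_1 fr, Finset.mul_sum]
  refine Finset.sum_congr rfl fun k _ => ?_
  rw [← semis.eq_1 fr, mul_smul_comm, aeval_mul_of_mul_eq_smul (fr.semis_sq_mul_J θ k), smul_smul]

theorem aeval_semis_imagPoly (θ : Fin m → ℝ) : aeval (fr.semis θ) (imagPoly θ) = 0 := by
  rw [aeval_imagPoly, aeval_semis_sq_mul_semis]
  refine Finset.sum_eq_zero fun k _ => ?_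
  rw [Lagrange.eval_nodal_at_node (v := fun j => -(θ j) ^ 2) (Finset.mem_univ k), mul_zero,
    zero_smul]

theorem isNilpotent_aeval_point (θ : Fin m → ℝ) :
    IsNilpotent (aeval (fr.point θ) (imagPoly θ)) :=
  isNilpotent_aeval_add_of_commute (fr.commute_N_semis θ).symm fr.nilp (fr.aeval_semis_imagPoly θ)

variable {θ : Fin m → ℝ}

/-- `S ^ 2` acts on `J k` as the scalar `-(θ k) ^ 2`, and these scalars are distinct, so a Lagrange
basis polynomial in `S ^ 2` isolates a single summand of `S`. This makes each complex structure a
polynomial in `S`. -/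
theorem J_eq (hθ : StrictMono θ) (h0 : ∀ j, 0 < θ j) (j : Fin m) :
    fr.J j = (θ j)⁻¹ • (aeval (fr.semis θ ^ 2)
      (Lagrange.basis Finset.univ (fun j => -(θ j) ^ 2) j) * fr.semis θ) := by
  have hinj := neg_sq_injective hθ h0
  rw [aeval_semis_sq_mul_semis, Finset.sum_eq_single j]
  · rw [Lagrange.eval_basis_self (v := fun j => -(θ j) ^ 2) hinj.injOn (Finset.mem_univ j), mul_one,
      smul_smul, inv_mul_cancel₀ (h0 j).ne', one_smul]
  · intro k _ hk
    rw [Lagrange.eval_basis_of_ne (v := fun j => -(θ j) ^ 2) hk.symm (Finset.mem_univ k), mul_zero,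
      zero_smul]
  · simp

/-- The semisimple part is characterized by its polynomial equation. -/
theorem semis_eq (hθ : StrictMono θ) (h0 : ∀ j, 0 < θ j) {S : 𝔸}
    (hS : S ∈ Algebra.adjoin ℝ {fr.point θ}) (hn : IsNilpotent (fr.point θ - S))
    (hz : aeval S (imagPoly θ) = 0) : fr.semis θ = S := by
  have hcomm {x : 𝔸} (hx : Commute x (fr.point θ)) : Commute x S :=
    Algebra.commute_of_mem_adjoin_singleton_of_commute hS hx
  have h1 : Commute (fr.semis θ) S :=
    hcomm ((Commute.refl _).add_right (fr.commute_N_semis θ).symm)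
  have h2 : Commute (fr.point θ) S := hcomm (Commute.refl _)
  have h3 : Commute fr.N S := hcomm ((fr.commute_N_semis θ).add_right (Commute.refl _))
  refine eq_of_commute_of_isNilpotent_sub h1 (fr.aeval_semis_imagPoly θ) hz
    (imagPoly_separable hθ h0) ?_
  have h4 : fr.semis θ - S = (fr.point θ - S) - fr.N := by rw [point]; abel
  rw [h4]
  refine Commute.isNilpotent_sub ?_ hn fr.nilp
  exact ((fr.commute_N_semis θ).add_right (Commute.refl _)).symm.sub_left h3.symm

theorem exists_semis_eq (hθ : StrictMono θ) (h0 : ∀ j, 0 < θ j) :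
    ∃ S ∈ Algebra.adjoin ℝ {fr.point θ}, IsNilpotent (fr.point θ - S) ∧
      aeval S (imagPoly θ) = 0 :=
  exists_mem_adjoin_isNilpotent_sub (fr.isNilpotent_aeval_point θ) (imagPoly_separable hθ h0)

theorem semis_mem_adjoin (hθ : StrictMono θ) (h0 : ∀ j, 0 < θ j) :
    fr.semis θ ∈ Algebra.adjoin ℝ {fr.point θ} := by
  obtain ⟨S, hS, hn, hz⟩ := fr.exists_semis_eq hθ h0
  rwa [fr.semis_eq hθ h0 hS hn hz]

theorem J_mem_adjoin (hθ : StrictMono θ) (h0 : ∀ j, 0 < θ j) (j : Fin m) :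
    fr.J j ∈ Algebra.adjoin ℝ {fr.point θ} := by
  rw [fr.J_eq hθ h0]
  have hS := fr.semis_mem_adjoin hθ h0
  refine Subalgebra.smul_mem _ (mul_mem ?_ hS) _
  exact Algebra.adjoin_le (Set.singleton_subset_iff.2 (pow_mem hS 2))
    (aeval_mem_adjoin_singleton _ _)

theorem N_mem_adjoin (hθ : StrictMono θ) (h0 : ∀ j, 0 < θ j) :
    fr.N ∈ Algebra.adjoin ℝ {fr.point θ} := by
  have : fr.N = fr.point θ - fr.semis θ := by rw [point]; abel
  rw [this]
  exact sub_mem (Algebra.self_mem_adjoin_singleton ℝ _) (fr.semis_mem_adjoin hθ h0)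

/-- Both semisimple parts coincide with the root of `imagPoly θ` found in the algebra generated by
the common point; interpolation recovers `J` from it and subtraction recovers `N`. -/
theorem eq_of_point_eq {fr fr' : ImagFrame 𝔸 m} (hθ : StrictMono θ) (h0 : ∀ j, 0 < θ j)
    (h : fr.point θ = fr'.point θ) : fr = fr' := by
  obtain ⟨S, hS, hn, hz⟩ := fr.exists_semis_eq hθ h0
  have h1 := fr.semis_eq hθ h0 hS hn hz
  have h2 := fr'.semis_eq hθ h0 (h ▸ hS) (h ▸ hn) hz
  refine ext' (funext fun j => ?_) ?_
  · rw [fr.J_eq hθ h0, fr'.J_eq hθ h0, h1, h2]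
  · rw [point, point, h1, h2] at h
    exact add_left_cancel h

/-- The frequencies of a frame element are determined by the element. -/
theorem isUnit_point_sq_add_iff (θ : Fin m → ℝ) {w : ℝ} (hw : 0 < w)
    (h0 : ∀ j, 0 < θ j) :
    IsUnit (fr.point θ ^ 2 + algebraMap ℝ 𝔸 (w ^ 2)) ↔ w ∉ Set.range θ := by
  constructor
  · rintro h ⟨j, rfl⟩
    have hN : Commute fr.N (fr.semis θ) := fr.commute_N_semis θ
    -- Since `S ^ 2 + θ j ^ 2` kills `J j`, only terms with a factor `N` survive and the product is
    -- nilpotent. An invertible first factor would make `J j` nilpotent, which `J j ^ 3 = -J j ≠ 0`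
    -- excludes.
    have key : (fr.point θ ^ 2 + algebraMap ℝ 𝔸 (θ j ^ 2)) * fr.J j =
        fr.N * ((fr.semis θ + fr.semis θ + fr.N) * fr.J j) := by
      have h1 := fr.semis_sq_mul_J θ j
      have h2 : fr.point θ ^ 2 = fr.semis θ ^ 2 + fr.N * (fr.semis θ + fr.semis θ + fr.N) := by
        rw [point]; simp only [sq, mul_add, add_mul, hN.eq]; abel
      rw [h2, add_mul, add_mul, h1, ← Algebra.smul_def, neg_smul, mul_assoc]; abel
    have hc1 : Commute fr.N ((fr.semis θ + fr.semis θ + fr.N) * fr.J j) :=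
      ((hN.add_right hN).add_right (Commute.refl _)).mul_right (fr.comm j)
    have hnil : IsNilpotent ((fr.point θ ^ 2 + algebraMap ℝ 𝔸 (θ j ^ 2)) * fr.J j) := by
      rw [key]; exact hc1.isNilpotent_mul_right fr.nilp
    have hSJ : Commute (fr.semis θ) (fr.J j) := by
      rw [Commute, SemiconjBy, semis_mul_J, J_mul_semis]
    have hc2 : Commute (fr.point θ ^ 2 + algebraMap ℝ 𝔸 (θ j ^ 2)) (fr.J j) :=
      ((hSJ.add_left (fr.comm j)).pow_left 2).add_left (Algebra.commutes _ _)
    obtain ⟨k, hk⟩ := hnil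
    rw [hc2.mul_pow, (h.pow k).mul_right_eq_zero] at hk
    have hJ (k : ℕ) : fr.J j ^ (k + 1) ≠ 0 := by
      induction k using Nat.strong_induction_on with
      | _ k ih =>
        match k with
        | 0 => simpa using fr.ne_zero j
        | 1 =>
          intro h
          apply fr.ne_zero j
          rw [← neg_eq_zero, ← fr.cube j, pow_succ, h, zero_mul]
        | k + 2 =>
          have : fr.J j ^ (k + 2 + 1) = -fr.J j ^ (k + 1) := by
            rw [add_assoc, pow_add, fr.cube, pow_succ, mul_neg]
          rw [this, neg_ne_zero]
          exact ih k (by omega)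
    exact hJ k (by rw [pow_succ, hk, zero_mul])
  · intro h
    have h1 : IsCoprime (imagPoly θ) (X ^ 2 + C (w ^ 2)) := by
      refine isCoprime_comp_sq_mul_X hw.ne' ?_
      rw [Lagrange.eval_nodal, Finset.prod_ne_zero_iff]
      intro j _ hj
      apply h
      refine ⟨j, (pow_left_inj₀ (h0 j).le hw.le two_ne_zero).1 ?_⟩
      linarith
    simpa using isUnit_aeval_of_isCoprime (fr.isNilpotent_aeval_point θ) h1

/-- Transport of a frame along an isomorphism of algebras. -/
def map {𝔹 : Type*} [Ring 𝔹] [Algebra ℝ 𝔹] (e : 𝔸 ≃ₐ[ℝ] 𝔹) : ImagFrame 𝔹 m where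
  J j := e (fr.J j)
  N := e fr.N
  J_mul_J i j h := by rw [← map_mul, fr.J_mul_J i j h, map_zero]
  cube j := by rw [← map_pow, fr.cube, map_neg]
  ne_zero j := by simpa using fr.ne_zero j
  comm j := (fr.comm j).map e
  nilp := fr.nilp.map e

theorem map_point {𝔹 : Type*} [Ring 𝔹] [Algebra ℝ 𝔹] (e : 𝔸 ≃ₐ[ℝ] 𝔹) (θ : Fin m → ℝ) :
    (fr.map e).point θ = e (fr.point θ) := by
  simp [point, semis, map]

theorem map_stratum {𝔹 : Type*} [Ring 𝔹] [Algebra ℝ 𝔹] (e : 𝔸 ≃ₐ[ℝ] 𝔹) :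
    (fr.map e).stratum = e '' fr.stratum := by
  ext B
  constructor
  · rintro ⟨θ, hθ, h0, C, rfl⟩
    refine ⟨_, ⟨θ, hθ, h0, Units.map (e.symm : 𝔹 →* 𝔸) C, rfl⟩, ?_⟩
    simp [map_point, ← map_inv]
  · rintro ⟨_, ⟨θ, hθ, h0, C, rfl⟩, rfl⟩
    refine ⟨θ, hθ, h0, Units.map (e : 𝔸 →* 𝔹) C, ?_⟩
    simp [map_point, ← map_inv]

theorem point_mem_stratum (hθ : StrictMono θ) (h0 : ∀ j, 0 < θ j) : fr.point θ ∈ fr.stratum :=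
  ⟨θ, hθ, h0, 1, by simp⟩

theorem conj_mem_stratum {A : 𝔸} (hA : A ∈ fr.stratum) (C : 𝔸ˣ) :
    C * A * (C⁻¹ : 𝔸ˣ) ∈ fr.stratum := by
  obtain ⟨θ, hθ, h0, D, rfl⟩ := hA
  exact ⟨θ, hθ, h0, C * D, by simp [mul_assoc]⟩

/-- The inner automorphism of a unit. -/
def conjEquiv (C : 𝔸ˣ) : 𝔸 ≃ₐ[ℝ] 𝔸 := MulSemiringAction.toAlgEquiv ℝ 𝔸 (ConjAct.toConjAct C)

theorem conjEquiv_apply (C : 𝔸ˣ) (x : 𝔸) : conjEquiv C x = C * x * (C⁻¹ : 𝔸ˣ) := rfl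

theorem stratum_map_conjEquiv (C : 𝔸ˣ) : (fr.map (conjEquiv C)).stratum = fr.stratum := by
  rw [map_stratum]
  ext A
  constructor
  · rintro ⟨B, hB, rfl⟩
    exact fr.conj_mem_stratum hB C
  · intro hA
    refine ⟨_, fr.conj_mem_stratum hA C⁻¹, ?_⟩
    simp [conjEquiv_apply, mul_assoc]

/-- Two frames with a common element in their strata have the same stratum. -/
theorem exists_eq_of_mem_stratum {m' : ℕ} {fr : ImagFrame 𝔸 m} {fr' : ImagFrame 𝔸 m'} {A : 𝔸}
    (h : A ∈ fr.stratum) (h' : A ∈ fr'.stratum) : m = m' ∧ fr.stratum = fr'.stratum := by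
  obtain ⟨θ, hθ, h0, C, rfl⟩ := h
  obtain ⟨θ', hθ', h0', C', h'⟩ := h'
  rw [← conjEquiv_apply, ← conjEquiv_apply, ← map_point, ← map_point] at h'
  rw [← fr.stratum_map_conjEquiv C, ← fr'.stratum_map_conjEquiv C']
  generalize fr.map (conjEquiv C) = g at *
  generalize fr'.map (conjEquiv C') = g' at *
  -- The frequencies are the `w > 0` for which `A ^ 2 + w ^ 2` is singular, hence depend on `A`
  -- alone; being listed in increasing order, they agree as tuples.
  have hr : Set.range θ = Set.range θ' := by
    ext w
    by_cases hw : 0 < w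
    · rw [← not_iff_not, ← g.isUnit_point_sq_add_iff θ hw h0, h',
        g'.isUnit_point_sq_add_iff θ' hw h0']
    · constructor
      · rintro ⟨j, rfl⟩; exact absurd (h0 j) hw
      · rintro ⟨j, rfl⟩; exact absurd (h0' j) hw
  obtain rfl : m = m' := by
    have := congrArg Set.ncard hr
    rwa [← Set.image_univ, ← Set.image_univ, Set.ncard_image_of_injective _ hθ.injective,
      Set.ncard_image_of_injective _ hθ'.injective, Set.ncard_univ, Set.ncard_univ, Nat.card_fin,
      Nat.card_fin] at this
  obtain rfl : θ = θ' := (hθ.range_inj hθ').1 hr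
  exact ⟨rfl, by rw [eq_of_point_eq hθ h0 h']⟩

/-- A frame from its semisimple and its nilpotent part. -/
theorem exists_point_eq {S N : 𝔸} (hc : Commute S N) (hN : IsNilpotent N) (hθ : StrictMono θ)
    (h0 : ∀ j, 0 < θ j) (hS : aeval S (imagPoly θ) = 0)
    (hu : ∀ j, ¬IsUnit ((S + N) ^ 2 + algebraMap ℝ 𝔸 (θ j ^ 2))) :
    ∃ fr : ImagFrame 𝔸 m, fr.point θ = S + N := by
  have hinj := neg_sq_injective hθ h0
  set v : Fin m → ℝ := fun j => -(θ j) ^ 2 with hv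
  set b := Lagrange.basis Finset.univ v with hb
  have hcomm {p : ℝ[X]} {x : 𝔸} (h : Commute x S) : Commute x (aeval (S ^ 2) p) :=
    Algebra.commute_of_mem_adjoin_singleton_of_commute (R := ℝ) (aeval_mem_adjoin_singleton _ _)
      (h.pow_right 2)
  set J : Fin m → 𝔸 := fun j => (θ j)⁻¹ • (aeval (S ^ 2) (b j) * S) with hJ
  have hSS : Commute S S := Commute.refl S
  have hnod (q : ℝ[X]) : aeval (S ^ 2) (q * Lagrange.nodal Finset.univ v) * S = 0 := by
    rw [map_mul, mul_assoc, ← aeval_imagPoly, hS, mul_zero]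
  have hSJ (j : Fin m) : S ^ 2 * J j = v j • J j := by
    have h1 : (X - C (v j)) * b j =
        C (Lagrange.nodalWeight Finset.univ v j) * Lagrange.nodal Finset.univ v := by
      rw [hb, Lagrange.basis_eq_prod_sub_inv_mul_nodal_div (Finset.mem_univ j), mul_left_comm,
        EuclideanDomain.mul_div_cancel' (X_sub_C_ne_zero _)
          (Lagrange.X_sub_C_dvd_nodal v (Finset.mem_univ j))]
    have h2 := hnod (C (Lagrange.nodalWeight Finset.univ v j))
    rw [← h1, map_mul, map_sub, aeval_X, aeval_C, sub_mul, sub_mul, sub_eq_zero, mul_assoc,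
      mul_assoc, ← Algebra.smul_def] at h2
    simp only [hJ, mul_smul_comm, h2]
    rw [smul_comm]
  have hJS (j : Fin m) : Commute (J j) S := ((hcomm hSS).symm.mul_left hSS).smul_left _
  have hN' (j : Fin m) : Commute N (J j) := ((hcomm hc.symm).mul_right hc.symm).smul_right _
  have hsum : ∑ j, θ j • J j = S := by
    have h1 (j : Fin m) : θ j • J j = aeval (S ^ 2) (b j) * S := by
      rw [hJ, smul_smul, mul_inv_cancel₀ (h0 j).ne', one_smul]
    simp only [h1, ← Finset.sum_mul, ← map_sum]
    -- The Lagrange basis sums to `1` only for a nonempty set of nodes. Without nodes `imagPoly θ`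
    -- is `X`, and `S = 0`.
    rcases isEmpty_or_nonempty (Fin m) with hm | hm
    · have : S = 0 := by simpa [imagPoly_eq_prod] using hS
      simp [this]
    · rw [hb, Lagrange.sum_basis hinj.injOn Finset.univ_nonempty, map_one, one_mul]
  have hsq (j : Fin m) : J j ^ 2 = (θ j)⁻¹ • (S * J j) := by
    have h1 : aeval (S ^ 2) (b j) * J j = J j := by
      rw [aeval_mul_of_mul_eq_smul (hSJ j), hb,
        Lagrange.eval_basis_self hinj.injOn (Finset.mem_univ j), one_smul]
    calc J j ^ 2 = (θ j)⁻¹ • (aeval (S ^ 2) (b j) * S * J j) := by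
          rw [sq]; nth_rw 1 [hJ]; rw [smul_mul_assoc]
      _ = (θ j)⁻¹ • (S * J j) := by
          rw [← (hcomm hSS).eq, mul_assoc, h1]
  -- If `J j` vanished, `S` would be killed by a polynomial coprime to `X ^ 2 + θ j ^ 2`, and the
  -- element excluded by `hu` would be a unit.
  have hne (j : Fin m) : J j ≠ 0 := by
    intro h
    have h1 : aeval S ((b j).comp (X ^ 2) * X) = 0 := by
      have h2 := smul_eq_zero_iff_right (inv_ne_zero (h0 j).ne') |>.1 h
      simpa [aeval_comp] using h2
    have h2 : IsCoprime ((b j).comp (X ^ 2) * X) (X ^ 2 + C (θ j ^ 2)) := by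
      refine isCoprime_comp_sq_mul_X (h0 j).ne' ?_
      change (b j).eval (v j) ≠ 0
      rw [hb, Lagrange.eval_basis_self hinj.injOn (Finset.mem_univ j)]
      exact one_ne_zero
    have h3 := isUnit_aeval_of_isCoprime (isNilpotent_aeval_add_of_commute hc hN h1) h2
    exact hu j (by simpa using h3)
  refine ⟨⟨J, N, ?_, ?_, hne, hN', hN⟩, ?_⟩
  · intro i j hij
    -- `S ^ 2` acts on the product by both scalars, which are distinct.
    have h1 : v i • (J i * J j) = v j • (J i * J j) := by
      rw [← smul_mul_assoc, ← hSJ, ← mul_smul_comm, ← hSJ, ← mul_assoc, ((hJS i).pow_right 2).eq]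
    by_contra h
    exact hij (hinj (smul_left_injective ℝ h h1))
  · intro j
    have hθ : θ j ≠ 0 := (h0 j).ne'
    rw [pow_succ, hsq, smul_mul_assoc, mul_assoc, ← sq, hsq, mul_smul_comm, ← mul_assoc, ← sq, hSJ,
      smul_smul, smul_smul, hv]
    have : (θ j)⁻¹ * (θ j)⁻¹ * -θ j ^ 2 = -1 := by field_simp
    rw [← neg_one_smul ℝ (J j), ← this]
  · rw [point, semis, hsum]

end ImagFrame

/-! ### Submanifold charts from immersions -/

section Charts

open Topology

variable {E E₁ : Type*} [NormedAddCommGroup E] [NormedSpace ℝ E] [FiniteDimensional ℝ E]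
  [NormedAddCommGroup E₁] [NormedSpace ℝ E₁] [FiniteDimensional ℝ E₁]

/-- An analytic immersion at `0` that is locally onto `M` gives a submanifold chart of `M`. -/
theorem exists_submanifold_chart {F : E₁ → E} {M : Set E} (hF : ContDiffAt ℝ ω F 0)
    {D : E₁ →L[ℝ] E} (hD : HasFDerivAt F D 0) (hinj : Function.Injective D)
    (hM : ∀ᶠ y in 𝓝 0, F y ∈ M)
    (hM' : ∀ U ∈ 𝓝 (0 : E₁), ∀ᶠ z in 𝓝 (F 0), z ∈ M → z ∈ F '' U) :
    ∃ φ : OpenPartialHomeomorph E E,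
      F 0 ∈ φ.source ∧ ContDiffOn ℝ ∞ φ φ.source ∧ ContDiffOn ℝ ∞ φ.symm φ.target ∧
      ∃ V : Submodule ℝ E, Module.finrank ℝ V = Module.finrank ℝ E₁ ∧
        φ '' (φ.source ∩ M) = φ.target ∩ (V : Set E) := by
  have := FiniteDimensional.complete ℝ E
  have := FiniteDimensional.complete ℝ E₁
  obtain ⟨W, hW⟩ := Submodule.exists_isCompl (LinearMap.range (D : E₁ →ₗ[ℝ] E))
  have hinj' : Function.Injective (D : E₁ →ₗ[ℝ] E) := hinj
  let e₀ : (E₁ × W) ≃ₗ[ℝ] E :=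
    ((LinearEquiv.ofInjective (D : E₁ →ₗ[ℝ] E) hinj').prodCongr (LinearEquiv.refl ℝ W)).trans
      (Submodule.prodEquivOfIsCompl _ _ hW)
  let e : (E₁ × W) ≃L[ℝ] E := e₀.toContinuousLinearEquiv
  have he (y : E₁ × W) : e y = D y.1 + y.2 := rfl
  -- Thickening `F` by a complement of the range of `D` makes it a local diffeomorphism. The chart
  -- is `e` after its inverse, so that the slice with zero `W`-component goes into the range of `D`.
  let Ψ : E₁ × W → E := fun y => F y.1 + y.2
  have hfst : ContDiffAt ℝ ω (fun y : E₁ × W => F y.1) 0 :=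
    ContDiffAt.comp (0 : E₁ × W) hF contDiffAt_fst
  have hΨ : ContDiffAt ℝ ω Ψ 0 :=
    hfst.add (W.subtypeL.contDiff.contDiffAt.comp (0 : E₁ × W) contDiffAt_snd)
  have hΨ' : HasFDerivAt Ψ (e : E₁ × W →L[ℝ] E) 0 := by
    have h1 : HasFDerivAt (fun y : E₁ × W => F y.1) (D.comp (ContinuousLinearMap.fst ℝ E₁ W)) 0 :=
      HasFDerivAt.comp (0 : E₁ × W) hD hasFDerivAt_fst
    have h2 : HasFDerivAt (fun y : E₁ × W => (y.2 : E))
        (W.subtypeL.comp (ContinuousLinearMap.snd ℝ E₁ W)) 0 :=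
      (W.subtypeL.comp (ContinuousLinearMap.snd ℝ E₁ W)).hasFDerivAt
    exact h1.add h2
  have hω : (ω : WithTop ℕ∞) ≠ 0 := by simp
  let ψ := hΨ.toOpenPartialHomeomorph Ψ hΨ' hω
  have hψ (y : E₁ × W) : ψ y = Ψ y := rfl
  have h0s : (0 : E₁ × W) ∈ ψ.source := hΨ.mem_toOpenPartialHomeomorph_source hΨ' hω
  have hΨ0 : Ψ 0 = F 0 := by simp [Ψ]
  have h0t : F 0 ∈ ψ.target := hΨ0 ▸ hΨ.image_mem_toOpenPartialHomeomorph_target hΨ' hω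
  have hs0 : ψ.symm (F 0) = 0 := by rw [← hΨ0, ← hψ, ψ.left_inv h0s]
  have hsymm : ContDiffAt ℝ ω ψ.symm (F 0) := hΨ0 ▸ hΨ.to_localInverse hΨ' hω
  have hcont : Filter.Tendsto ψ.symm (𝓝 (F 0)) (𝓝 0) := by
    simpa [ContinuousAt, hs0] using hsymm.continuousAt
  -- Being `ContDiffAt` of order `ω` at a point spreads to a neighbourhood, which order `∞` at a
  -- point does not give; hence the analyticity assumption.
  have htop : (ω : WithTop ℕ∞) ≠ ∞ := by simp
  have hev : ∀ᶠ z in 𝓝 (F 0), z ∈ ψ.target ∧ ContDiffAt ℝ ω ψ.symm z ∧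
      ContDiffAt ℝ ω Ψ (ψ.symm z) ∧ F (ψ.symm z).1 ∈ M ∧
      (z ∈ M → z ∈ F '' {y | (y, 0) ∈ ψ.source}) := by
    have hU : {y : E₁ | (y, (0 : W)) ∈ ψ.source} ∈ 𝓝 0 := by
      have : ContinuousAt (fun y : E₁ => (y, (0 : W))) 0 := by fun_prop
      exact this.preimage_mem_nhds (ψ.open_source.mem_nhds h0s)
    filter_upwards [ψ.open_target.mem_nhds h0t, hsymm.eventually htop,
      hcont.eventually (hΨ.eventually htop),
      ((continuous_fst.tendsto (0 : E₁ × W)).comp hcont).eventually hM, hM' _ hU]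
      with z h1 h2 h3 h4 h5 using ⟨h1, h2, h3, h4, h5⟩
  obtain ⟨O, hO, hOo, hxO⟩ := eventually_nhds_iff.1 hev
  let φ : OpenPartialHomeomorph E E :=
    (ψ.symm.restrOpen O hOo).transHomeomorph e.toHomeomorph
  have hsrc : φ.source = ψ.target ∩ O := rfl
  have hsO : φ.source = O := by
    rw [hsrc, Set.inter_eq_right]; exact fun z hz => (hO z hz).1
  have hφ (z : E) : φ z = e (ψ.symm z) := rfl
  refine ⟨φ, hsO ▸ hxO, ?_, ?_, LinearMap.range (D : E₁ →ₗ[ℝ] E),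
    LinearMap.finrank_range_of_inj hinj', ?_⟩
  · intro z hz
    rw [hsO] at hz
    exact ((e.contDiff.contDiffAt.comp z (hO z hz).2.1).of_le le_top).contDiffWithinAt
  · intro z hz
    have h1 := φ.map_target hz
    have h2 : ψ.symm (φ.symm z) = e.symm z := by
      rw [e.eq_symm_apply, ← hφ, φ.right_inv hz]
    rw [hsO] at h1
    have h3 := (hO _ h1).2.2.1
    rw [h2] at h3
    exact ((h3.comp z e.symm.contDiff.contDiffAt).of_le le_top).contDiffWithinAt
  · have hzero (z : E) : φ z ∈ LinearMap.range (D : E₁ →ₗ[ℝ] E) ↔ (ψ.symm z).2 = 0 := by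
      rw [hφ, he]
      constructor
      · rintro ⟨y, hy⟩
        have h1 : e ((ψ.symm z).1 - y, (ψ.symm z).2) = 0 := by
          rw [he, map_sub, sub_add_eq_add_sub, sub_eq_zero]
          exact hy.symm
        have h2 := e.map_eq_zero_iff.1 h1
        exact congrArg Prod.snd h2
      · intro h
        rw [h]
        exact ⟨(ψ.symm z).1, by simp⟩
    have key (z : E) (hz : z ∈ φ.source) :
        z ∈ M ↔ φ z ∈ (LinearMap.range (D : E₁ →ₗ[ℝ] E) : Set E) := by
      rw [SetLike.mem_coe, hzero]
      rw [hsO] at hz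
      obtain ⟨ht, -, -, h1, h2⟩ := hO z hz
      constructor
      · intro hzM
        obtain ⟨y, hy, rfl⟩ := h2 hzM
        have : F y = ψ (y, 0) := by simp [hψ, Ψ]
        rw [this, ψ.left_inv hy]
      · intro h
        have : z = F (ψ.symm z).1 := by
          conv_lhs => rw [← ψ.right_inv ht, hψ]
          simp [Ψ, h]
        rwa [this]
    ext w
    constructor
    · rintro ⟨z, ⟨hz, hzM⟩, rfl⟩
      exact ⟨φ.map_source hz, (key z hz).1 hzM⟩
    · rintro ⟨hw, hwV⟩
      refine ⟨φ.symm w, ⟨φ.map_target hw, ?_⟩, φ.right_inv hw⟩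
      rw [key _ (φ.map_target hw), φ.right_inv hw]
      exact hwV

theorem IsEmbeddedSubmanifold.image {E' : Type*} [NormedAddCommGroup E'] [NormedSpace ℝ E']
    [FiniteDimensional ℝ E'] {d : ℕ} {M : Set E} (h : IsEmbeddedSubmanifold d M) (e : E ≃L[ℝ] E') :
    IsEmbeddedSubmanifold d (e '' M) := by
  rintro _ ⟨x, hx, rfl⟩
  obtain ⟨φ, hxs, hφ, hφs, V, hV, hVM⟩ := h x hx
  let φ' : OpenPartialHomeomorph E' E' :=
    (e.symm.toHomeomorph.transOpenPartialHomeomorph φ).transHomeomorph e.toHomeomorph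
  have hsrc : φ'.source = e.symm ⁻¹' φ.source := rfl
  have htgt : φ'.target = e.symm ⁻¹' φ.target := rfl
  have hφ' (z : E') : φ' z = e (φ (e.symm z)) := rfl
  refine ⟨φ', by simpa [hsrc] using hxs, ?_, ?_, V.map (e : E →ₗ[ℝ] E'), ?_, ?_⟩
  · exact e.contDiff.comp_contDiffOn (hφ.comp e.symm.contDiff.contDiffOn fun z hz => hz)
  · exact e.contDiff.comp_contDiffOn (hφs.comp e.symm.contDiff.contDiffOn fun z hz => hz)
  · rw [← hV]; exact LinearEquiv.finrank_map_eq e.toLinearEquiv V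
  · have h1 : φ'.source ∩ e '' M = e '' (φ.source ∩ M) := by
      rw [Set.image_inter e.injective, hsrc]
      congr 1
      exact (e.image_eq_preimage_symm φ.source).symm
    have h2 : φ'.target ∩ (V.map (e : E →ₗ[ℝ] E') : Set E') = e '' (φ.target ∩ V) := by
      rw [Set.image_inter e.injective, htgt]
      congr 1
      exact (e.image_eq_preimage_symm φ.target).symm
    rw [h1, h2, ← hVM, Set.image_image, Set.image_image]
    exact Set.image_congr fun z _ => by simp [hφ']

end Charts

/-! ### Eigenvalues, determinants and continuity of the frequencies -/

/-- Spectral mapping, applied to a power of `p` that kills `M`. -/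
theorem Matrix.aeval_eq_zero_of_isRoot_charpoly_map {ι : Type*} [Fintype ι] [DecidableEq ι]
    {M : Matrix ι ι ℝ} {p : ℝ[X]} (h : IsNilpotent (aeval M p)) {z : ℂ}
    (hz : (M.map (algebraMap ℝ ℂ)).charpoly.IsRoot z) : aeval z p = 0 := by
  obtain ⟨k, hk⟩ := h
  rw [← Matrix.mem_spectrum_iff_isRoot_charpoly] at hz
  have h1 : aeval (M.map (algebraMap ℝ ℂ)) ((p ^ k).map (algebraMap ℝ ℂ)) = 0 := by
    have h2 := aeval_algHom_apply (Algebra.ofId ℝ ℂ).mapMatrix M (p ^ k)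
    rw [aeval_map_algebraMap]
    refine h2.trans ?_
    rw [map_pow, hk, map_zero]
  have h2 := spectrum.subset_polynomial_aeval (M.map (algebraMap ℝ ℂ))
    ((p ^ k).map (algebraMap ℝ ℂ)) ⟨z, hz, rfl⟩
  rw [h1, spectrum.mem_iff, sub_zero] at h2
  have h3 : eval z ((p ^ k).map (algebraMap ℝ ℂ)) = 0 := by
    by_contra h
    exact h2 ((IsUnit.mk0 _ h).map (algebraMap ℂ _))
  rw [eval_map_algebraMap, map_pow] at h3
  exact eq_zero_of_pow_eq_zero h3

/-- The determinant is the product of `x - z` over the complex eigenvalues `z`, all of which are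
roots of `p`. Contrapositively, a small determinant forces a root of `p` close to `x`. -/
theorem Matrix.pow_card_le_abs_det_scalar_sub {ι : Type*} [Fintype ι] [DecidableEq ι]
    {M : Matrix ι ι ℝ} {p : ℝ[X]} (h : IsNilpotent (aeval M p)) {x δ : ℝ} (hδ : 0 ≤ δ)
    (hx : ∀ z : ℂ, aeval z p = 0 → δ ≤ ‖(x : ℂ) - z‖) :
    δ ^ Fintype.card ι ≤ |(Matrix.scalar ι x - M).det| := by
  set χ := (M.map (algebraMap ℝ ℂ)).charpoly with hχ
  have hmon : χ.Monic := Matrix.charpoly_monic _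
  have h1 : ((Matrix.scalar ι x - M).det : ℂ) = χ.eval (x : ℂ) := by
    rw [← Matrix.eval_charpoly, hχ, Matrix.charpoly_map, eval_map_algebraMap]
    exact (aeval_algebraMap_apply ℂ x M.charpoly).symm
  have h2 : |(Matrix.scalar ι x - M).det| = ‖χ.eval (x : ℂ)‖ := by
    rw [← h1, Complex.norm_real, Real.norm_eq_abs]
  rw [h2, (IsAlgClosed.splits χ).eval_eq_prod_roots_of_monic hmon, ← Matrix.charpoly_natDegree_eq_dim
    (M.map (algebraMap ℝ ℂ)), ← hχ, (IsAlgClosed.splits χ).natDegree_eq_card_roots]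
  have hroot : ∀ z ∈ χ.roots, δ ≤ ‖(x : ℂ) - z‖ := fun z hz =>
    hx z (Matrix.aeval_eq_zero_of_isRoot_charpoly_map h ((mem_roots hmon.ne_zero).1 hz))
  generalize χ.roots = s at hroot
  induction s using Multiset.induction_on with
  | empty => simp
  | cons a s ih =>
    rw [Multiset.map_cons, Multiset.prod_cons, norm_mul, Multiset.card_cons, pow_succ']
    exact mul_le_mul (hroot a (Multiset.mem_cons_self a s))
      (ih fun z hz => hroot z (Multiset.mem_cons_of_mem hz)) (by positivity) (norm_nonneg _)

theorem isUnit_of_isUnit_det_leftMulMatrix {K 𝔸 ι : Type*} [Field K] [Ring 𝔸] [Algebra K 𝔸]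
    [Fintype ι] [DecidableEq ι] (b : Module.Basis ι K 𝔸) {x : 𝔸}
    (h : IsUnit (Algebra.leftMulMatrix b x).det) : IsUnit x := by
  rw [← Matrix.isUnit_iff_isUnit_det] at h
  rw [← Algebra.lmul_isUnit_iff (R := K)]
  exact (LinearMap.isUnit_toMatrix_iff b).1 h

namespace ImagFrame

open Topology

variable {𝔸 : Type*} [NormedRing 𝔸] [NormedAlgebra ℝ 𝔸] [FiniteDimensional ℝ 𝔸] {m : ℕ}
  (fr : ImagFrame 𝔸 m) {θ : Fin m → ℝ}

/-- The frequencies depend continuously on the elements of a stratum. -/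
theorem eventually_abs_sub_lt (hθ : StrictMono θ) (h0 : ∀ j, 0 < θ j) {ε : ℝ} (hε : 0 < ε) :
    ∀ᶠ z in 𝓝 (fr.point θ), ∀ θ' : Fin m → ℝ, StrictMono θ' → (∀ j, 0 < θ' j) → ∀ C : 𝔸ˣ,
      z = C * fr.point θ' * (C⁻¹ : 𝔸ˣ) → ∀ j, |θ' j - θ j| < ε := by
  set b := Module.finBasis ℝ 𝔸
  set D := Module.finrank ℝ 𝔸
  -- The first bound keeps the root `0` away from `-(θ j) ^ 2`; the half gaps keep the nearby
  -- frequencies in order; the third turns closeness of squares into closeness of frequencies.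
  obtain ⟨δ, ⟨hδ1, hδ2, hδ3⟩, hδ0⟩ : ∃ δ : ℝ, ((∀ j, δ ≤ θ j ^ 2) ∧
      (∀ i j, i < j → δ ≤ (θ j ^ 2 - θ i ^ 2) / 2) ∧ ∀ j, δ ≤ ε * θ j) ∧ 0 < δ := by
    have hle {c : ℝ} (hc : 0 < c) : ∀ᶠ δ in 𝓝[>] (0 : ℝ), δ ≤ c :=
      nhdsWithin_le_nhds (Iic_mem_nhds hc)
    have h1 : ∀ᶠ δ in 𝓝[>] (0 : ℝ), ((∀ j, δ ≤ θ j ^ 2) ∧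
        (∀ i j, i < j → δ ≤ (θ j ^ 2 - θ i ^ 2) / 2) ∧ ∀ j, δ ≤ ε * θ j) := by
      refine (Filter.eventually_all.2 fun j => hle (pow_pos (h0 j) 2)).and
        (Filter.Eventually.and (Filter.eventually_all.2 fun i => Filter.eventually_all.2 fun j =>
          Filter.eventually_all.2 fun hij => hle ?_)
          (Filter.eventually_all.2 fun j => hle (mul_pos hε (h0 j))))
      have := pow_lt_pow_left₀ (hθ hij) (h0 i).le two_ne_zero
      linarith
    exact (h1.and self_mem_nhdsWithin).exists
  -- The characteristic polynomial of left multiplication by `z ^ 2`, evaluated at `-(θ j) ^ 2`. It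
  -- vanishes at the base point, so it is small nearby and some `-(θ' k) ^ 2` must be within `δ`.
  let Δ : Fin m → 𝔸 → ℝ := fun j z =>
    (Matrix.scalar (Fin D) (-(θ j) ^ 2) - Algebra.leftMulMatrix b (z ^ 2)).det
  have hcont (j : Fin m) : Continuous (Δ j) := by
    have h1 : Continuous (Algebra.leftMulMatrix b) :=
      (Algebra.leftMulMatrix b).toLinearMap.continuous_of_finiteDimensional
    exact (continuous_const.sub (h1.comp (continuous_pow 2))).matrix_det
  have hzero (j : Fin m) : Δ j (fr.point θ) = 0 := by
    by_contra h
    have h1 := (fr.isUnit_point_sq_add_iff θ (h0 j) h0).not_left.2 (by simp)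
    apply h1
    rw [← IsUnit.neg_iff]
    apply isUnit_of_isUnit_det_leftMulMatrix b
    have h2 : Algebra.leftMulMatrix b (-(fr.point θ ^ 2 + algebraMap ℝ 𝔸 (θ j ^ 2))) =
        Matrix.scalar (Fin D) (-(θ j) ^ 2) - Algebra.leftMulMatrix b (fr.point θ ^ 2) := by
      have h3 : Matrix.scalar (Fin D) (-(θ j) ^ 2) =
          -algebraMap ℝ (Matrix (Fin D) (Fin D) ℝ) (θ j ^ 2) := map_neg _ _
      rw [map_neg, map_add, AlgHom.commutes, h3]
      abel
    rw [h2]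
    exact isUnit_iff_ne_zero.2 h
  have hev : ∀ᶠ z in 𝓝 (fr.point θ), ∀ j, |Δ j z| < δ ^ D := by
    refine Filter.eventually_all.2 fun j => ?_
    refine ((hcont j).abs.tendsto _).eventually (gt_mem_nhds ?_)
    rw [hzero, abs_zero]
    positivity
  filter_upwards [hev] with z hz θ' hθ' h0' C hC
  have hnil : IsNilpotent (aeval (Algebra.leftMulMatrix b (z ^ 2))
      ((Lagrange.nodal Finset.univ fun j => -(θ' j) ^ 2) * X)) := by
    rw [aeval_algHom_apply]
    refine IsNilpotent.map ?_ _
    have h1 := (fr.map (conjEquiv C)).isNilpotent_aeval_point θ'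
    rw [map_point, conjEquiv_apply, ← hC, aeval_imagPoly] at h1
    rw [map_mul, aeval_X, sq z, ← mul_assoc, ← sq]
    refine Commute.isNilpotent_mul_right ?_ h1
    refine Commute.mul_left ?_ (Commute.refl z)
    exact (Algebra.commute_of_mem_adjoin_singleton_of_commute (R := ℝ)
      (aeval_mem_adjoin_singleton _ _) ((Commute.refl z).pow_right 2)).symm
  have hex (j : Fin m) : ∃ k, |θ' k ^ 2 - θ j ^ 2| < δ := by
    by_contra! hfar
    refine absurd (hz j) (not_lt.2 ?_)
    have := Matrix.pow_card_le_abs_det_scalar_sub hnil (x := -(θ j) ^ 2) hδ0.le ?_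
    · rwa [Fintype.card_fin] at this
    intro w hw
    rw [map_mul, aeval_X, mul_eq_zero] at hw
    rcases hw with hw | rfl
    · simp only [Lagrange.nodal, map_prod, Finset.prod_eq_zero_iff, map_sub, aeval_X, aeval_C,
        sub_eq_zero] at hw
      obtain ⟨k, -, rfl⟩ := hw
      refine (hfar k).trans_eq ?_
      rw [Complex.coe_algebraMap, ← Complex.ofReal_sub, Complex.norm_real, Real.norm_eq_abs]
      congr 1; ring
    · rw [sub_zero, Complex.norm_real, Real.norm_eq_abs, abs_neg, abs_of_nonneg (sq_nonneg _)]
      exact hδ1 j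
  choose k hk using hex
  -- A strictly increasing self-map of `Fin m` is the identity, so the frequencies are matched index
  -- by index.
  have hmono : StrictMono k := by
    intro i j hij
    have h1 := abs_lt.1 (hk i)
    have h2 := abs_lt.1 (hk j)
    have h3 := hδ2 i j hij
    have h4 : θ' (k i) ^ 2 < θ' (k j) ^ 2 := by linarith
    exact hθ'.lt_iff_lt.1 (lt_of_pow_lt_pow_left₀ 2 (h0' _).le h4)
  intro j
  have h1 := hk j
  rw [hmono.eq_id, id] at h1
  have h2 : |θ' j - θ j| * (θ' j + θ j) < ε * θ j := by
    calc |θ' j - θ j| * (θ' j + θ j) = |θ' j ^ 2 - θ j ^ 2| := by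
          rw [sq_sub_sq, abs_mul, abs_of_pos (add_pos (h0' j) (h0 j)), mul_comm]
      _ < δ := h1
      _ ≤ ε * θ j := hδ3 j
  by_contra! h3
  have := h0 j
  have := h0' j
  nlinarith

end ImagFrame

/-! ### Conjugators close to one -/

section Conjugation

variable {𝔸 : Type*} [NormedRing 𝔸] [NormedAlgebra ℝ 𝔸] [FiniteDimensional ℝ 𝔸]

/-- Near `A`, a conjugate of `B` with `B` having a centralizer as large as that of `A` is
a conjugate of `B` by an element near `1`. -/
theorem exists_conj_near_one {A : 𝔸} {Zc : Submodule ℝ 𝔸}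
    (hZ : IsCompl (Subalgebra.toSubmodule (Subalgebra.centralizer ℝ {A})) Zc)
    {ε : ℝ} (hε : 0 < ε) :
    ∃ η > 0, ∀ (B z : 𝔸) (C : 𝔸ˣ), z = C * B * (C⁻¹ : 𝔸ˣ) → ‖B - A‖ < η → ‖z - A‖ < η →
      Subalgebra.centralizer ℝ {B} = Subalgebra.centralizer ℝ {A} →
      ∃ X ∈ Zc, ‖X‖ < ε ∧ z * (1 + X) = (1 + X) * B := by
  have hmem {A x : 𝔸} : x ∈ Subalgebra.toSubmodule (Subalgebra.centralizer ℝ {A}) ↔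
      A * x = x * A := by simp [Subalgebra.mem_centralizer_iff]
  -- The kernel of `L z B` is `C` times the centralizer of `B`, so it has the dimension of the
  -- centralizer of `A`. For `z`, `B` near `A` it still meets `Zc` trivially, hence is a complement
  -- of `Zc`; the component of `1` in this kernel is the required `1 + X`.
  let L : 𝔸 → 𝔸 → 𝔸 →ₗ[ℝ] 𝔸 := fun z B => LinearMap.mulLeft ℝ z - LinearMap.mulRight ℝ B
  have hL (z B x : 𝔸) : L z B x = z * x - x * B := rfl
  have hker : LinearMap.ker ((L A A).comp Zc.subtype) = ⊥ := by
    rw [LinearMap.ker_eq_bot']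
    intro x hx
    have h1 : A * (x : 𝔸) = x * A := sub_eq_zero.1 hx
    have h2 := hZ.disjoint.le_bot ⟨hmem.2 h1, x.2⟩
    exact Subtype.ext h2
  obtain ⟨K, hK, hanti⟩ := LinearMap.exists_antilipschitzWith _ hker
  have hK0 : (0 : ℝ) < K := hK
  have hbound (x : 𝔸) (hx : x ∈ Zc) : ‖x‖ ≤ K * ‖L A A x‖ := by
    simpa [dist_eq_norm] using hanti.le_mul_dist ⟨x, hx⟩ 0
  -- Replacing `L A A` by `L z B` costs at most `2 * η` in norm: the first condition lets half of
  -- the lower bound on `Zc` absorb this, and the second is the final estimate on `X`.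
  obtain ⟨η, hη, hη1, hη2⟩ : ∃ η : ℝ, 0 < η ∧ K * (2 * η) ≤ 1 / 2 ∧
      4 * K * (‖(1 : 𝔸)‖ * η) < ε := by
    have h1 : ∀ᶠ η : ℝ in nhdsWithin (0 : ℝ) (Set.Ioi 0), (K : ℝ) * (2 * η) ≤ 1 / 2 ∧
        4 * K * (‖(1 : 𝔸)‖ * η) < ε := by
      refine nhdsWithin_le_nhds (Filter.Eventually.and ?_ ?_)
      · have : Filter.Tendsto (fun η : ℝ => K * (2 * η)) (nhds 0) (nhds (K * (2 * 0))) :=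
          Continuous.tendsto (by fun_prop) 0
        exact this.eventually (Iic_mem_nhds (by norm_num))
      · have : Filter.Tendsto (fun η : ℝ => 4 * K * (‖(1 : 𝔸)‖ * η)) (nhds 0)
            (nhds (4 * K * (‖(1 : 𝔸)‖ * 0))) := Continuous.tendsto (by fun_prop) 0
        exact this.eventually (gt_mem_nhds (by simpa using hε))
    obtain ⟨η, h2, h3⟩ := (h1.and self_mem_nhdsWithin).exists
    exact ⟨η, h3, h2.1, h2.2⟩
  refine ⟨η, hη, fun B z C hz hB hzA hc => ?_⟩
  have hdiff (x : 𝔸) : ‖L A A x‖ ≤ ‖L z B x‖ + ‖x‖ * (2 * η) := by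
    have h1 : L A A x = L z B x - ((z - A) * x - x * (B - A)) := by
      simp only [hL, sub_mul, mul_sub]; abel
    have h2 : ‖(z - A) * x - x * (B - A)‖ ≤ ‖x‖ * (2 * η) := by
      calc _ ≤ ‖z - A‖ * ‖x‖ + ‖x‖ * ‖B - A‖ :=
            (norm_sub_le _ _).trans (add_le_add (norm_mul_le _ _) (norm_mul_le _ _))
        _ ≤ η * ‖x‖ + ‖x‖ * η := by gcongr
        _ = ‖x‖ * (2 * η) := by ring
    rw [h1]
    exact (norm_sub_le _ _).trans (by gcongr)
  have hbound' (x : 𝔸) (hx : x ∈ Zc) : ‖x‖ ≤ 2 * K * ‖L z B x‖ := by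
    have h1 := hbound x hx
    have h2 : K * ‖L A A x‖ ≤ K * (‖L z B x‖ + ‖x‖ * (2 * η)) := by gcongr; exact hdiff x
    have h3 : K * (2 * η) * ‖x‖ ≤ 1 / 2 * ‖x‖ := by gcongr
    nlinarith
  let e : 𝔸 ≃ₗ[ℝ] 𝔸 := LinearEquiv.ofLinearMap (LinearMap.mulLeft ℝ (C : 𝔸))
    (LinearMap.mulLeft ℝ ((C⁻¹ : 𝔸ˣ) : 𝔸)) (by ext; simp) (by ext; simp)
  have hkerL : LinearMap.ker (L z B) =
      (Subalgebra.toSubmodule (Subalgebra.centralizer ℝ {B})).map (e : 𝔸 →ₗ[ℝ] 𝔸) := by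
    ext x
    rw [LinearMap.mem_ker, hL, sub_eq_zero, hz, Submodule.mem_map]
    constructor
    · intro h
      refine ⟨(C⁻¹ : 𝔸ˣ) * x, hmem.2 ?_, by simp [e]⟩
      rw [mul_assoc, ← h]; simp [mul_assoc]
    · rintro ⟨y, hy, rfl⟩
      have h2 := hmem.1 hy
      simp [e, mul_assoc, h2]
  have hdisj : Disjoint (LinearMap.ker (L z B)) Zc := by
    rw [Submodule.disjoint_def]
    intro x hx hx'
    have h1 := hbound' x hx'
    rw [LinearMap.mem_ker.1 hx, norm_zero, mul_zero] at h1
    exact norm_le_zero_iff.1 h1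
  have htop : LinearMap.ker (L z B) ⊔ Zc = ⊤ := by
    refine Submodule.eq_top_of_disjoint _ _ ?_ hdisj
    rw [hkerL, LinearEquiv.finrank_map_eq, hc, Submodule.finrank_add_eq_of_isCompl hZ]
  obtain ⟨k, hk, y, hy, hky⟩ := Submodule.mem_sup.1 (htop ▸ Submodule.mem_top : (1 : 𝔸) ∈ _)
  have hX : L z B (1 + -y) = 0 := by
    rw [← hky, add_neg_cancel_right]; exact hk
  refine ⟨-y, neg_mem hy, ?_, sub_eq_zero.1 hX⟩
  have h1 : L z B (-y) = -L z B 1 := by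
    rw [map_add] at hX
    exact eq_neg_of_add_eq_zero_right hX
  have h2 : ‖L z B 1‖ ≤ ‖(1 : 𝔸)‖ * (2 * η) := by
    have h3 : L z B 1 = (z - A) * 1 - 1 * (B - A) := by simp [hL]
    rw [h3]
    calc _ ≤ ‖z - A‖ * ‖(1 : 𝔸)‖ + ‖(1 : 𝔸)‖ * ‖B - A‖ :=
          (norm_sub_le _ _).trans (add_le_add (norm_mul_le _ _) (norm_mul_le _ _))
      _ ≤ η * ‖(1 : 𝔸)‖ + ‖(1 : 𝔸)‖ * η := by gcongr
      _ = ‖(1 : 𝔸)‖ * (2 * η) := by ring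
  calc ‖-y‖ ≤ 2 * K * ‖L z B (-y)‖ := hbound' _ (neg_mem hy)
    _ = 2 * K * ‖L z B 1‖ := by rw [h1, norm_neg]
    _ ≤ 2 * K * (‖(1 : 𝔸)‖ * (2 * η)) := by gcongr
    _ = 4 * K * (‖(1 : 𝔸)‖ * η) := by ring
    _ < ε := hη2

end Conjugation

/-! ### Strata are submanifolds -/

namespace ImagFrame

open Topology

section Algebraic

variable {𝔸 : Type*} [Ring 𝔸] [Algebra ℝ 𝔸] {m : ℕ} (fr : ImagFrame 𝔸 m) {θ : Fin m → ℝ}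

/-- The common centralizer of the elements attached to a frame. -/
def centralizer : Subalgebra ℝ 𝔸 := Subalgebra.centralizer ℝ (insert fr.N (Set.range fr.J))

theorem mem_centralizer_iff {x : 𝔸} :
    x ∈ fr.centralizer ↔ Commute x fr.N ∧ ∀ j, Commute x (fr.J j) := by
  simp [centralizer, Subalgebra.mem_centralizer_iff, Commute, SemiconjBy, eq_comm]

/-- `N` and all `J j` are polynomials in the point. Independence of `θ` is what keeps the dimension
of the centralizer constant along a stratum. -/
theorem centralizer_point (hθ : StrictMono θ) (h0 : ∀ j, 0 < θ j) :
    Subalgebra.centralizer ℝ {fr.point θ} = fr.centralizer := by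
  ext x
  rw [mem_centralizer_iff]
  have h1 : x ∈ Subalgebra.centralizer ℝ {fr.point θ} ↔ Commute x (fr.point θ) := by
    simp [Subalgebra.mem_centralizer_iff, Commute, SemiconjBy, eq_comm]
  rw [h1]
  constructor
  · exact fun h => ⟨Algebra.commute_of_mem_adjoin_singleton_of_commute (fr.N_mem_adjoin hθ h0) h,
      fun j => Algebra.commute_of_mem_adjoin_singleton_of_commute (fr.J_mem_adjoin hθ h0 j) h⟩
  · rintro ⟨h, h'⟩
    exact (Commute.sum_right _ _ _ fun j _ => (h' j).smul_right _).add_right h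

theorem commute_J_J (i j : Fin m) : Commute (fr.J i) (fr.J j) := by
  rcases eq_or_ne i j with rfl | h
  · exact Commute.refl _
  · rw [Commute, SemiconjBy, fr.J_mul_J i j h, fr.J_mul_J j i h.symm]

theorem point_add (θ t : Fin m → ℝ) : fr.point (θ + t) = fr.point θ + fr.semis t := by
  simp only [point, semis, Pi.add_apply, add_smul, Finset.sum_add_distrib]
  abel

/-- The tangent vectors along the frequencies are transversal to the conjugacy class. -/
theorem eq_zero_of_semis_eq_bracket [FiniteDimensional ℝ 𝔸] {t : Fin m → ℝ} {X : 𝔸}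
    (h : X * fr.point θ - fr.point θ * X + fr.semis t = 0) : t = 0 := by
  funext j
  set A := fr.point θ
  have hJA : Commute (fr.J j) A :=
    (Commute.sum_right _ _ _ fun i _ => (fr.commute_J_J j i).smul_right _).add_right
      (fr.comm j).symm
  -- Multiplying by `J j`, which commutes with `A`, exhibits `t j • J j ^ 2` as a commutator, so its
  -- trace in the regular representation is zero. But `-J j ^ 2` is a nonzero idempotent, whose
  -- trace is not zero.
  have h1 : A * (X * fr.J j) - X * fr.J j * A = t j • fr.J j ^ 2 := by
    rw [← semis_mul_J, mul_assoc, hJA.eq, ← mul_assoc, ← mul_assoc, ← sub_mul]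
    congr 1
    rw [← sub_eq_zero, ← neg_eq_zero, ← h]
    abel
  set tr := LinearMap.trace ℝ 𝔸 ∘ₗ (Algebra.lmul ℝ 𝔸).toLinearMap
  have htr (x : 𝔸) : tr x = LinearMap.trace ℝ 𝔸 (Algebra.lmul ℝ 𝔸 x) := rfl
  have h2 : t j * tr (fr.J j ^ 2) = 0 := by
    rw [← smul_eq_mul, ← map_smul, ← h1, map_sub, htr, htr, map_mul _ A, map_mul _ (X * fr.J j),
      LinearMap.trace_mul_comm, sub_self]
  refine (mul_eq_zero.1 h2).resolve_right fun h3 => fr.ne_zero j ?_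
  have hid : IsIdempotentElem (Algebra.lmul ℝ 𝔸 (-fr.J j ^ 2)) := by
    rw [IsIdempotentElem, ← map_mul]
    congr 1
    rw [neg_mul_neg, ← pow_add, show 2 + 2 = 3 + 1 from rfl, pow_succ, fr.cube, neg_mul, sq]
  have h4 : Algebra.lmul ℝ 𝔸 (-fr.J j ^ 2) = 0 := by
    refine LinearMap.IsIdempotentElem.eq_zero_of_trace_eq_zero hid ?_
    rw [← htr, map_neg, h3, neg_zero]
  have h5 : -fr.J j ^ 2 = 0 := by
    simpa using LinearMap.congr_fun h4 1
  rw [← neg_eq_zero, ← fr.cube, pow_succ, neg_eq_zero.1 h5, zero_mul]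

end Algebraic

variable {𝔸 : Type*} [NormedRing 𝔸] [NormedAlgebra ℝ 𝔸] [FiniteDimensional ℝ 𝔸] {m : ℕ}
  (fr : ImagFrame 𝔸 m) {θ : Fin m → ℝ}

/-- The parametrization varies the conjugator `1 + X`, with `X` in a complement of the centralizer,
and the frequencies independently. Injectivity of the derivative is `eq_zero_of_semis_eq_bracket`;
local surjectivity onto the stratum combines `eventually_abs_sub_lt` with `exists_conj_near_one`. -/
theorem exists_chart_point (hθ : StrictMono θ) (h0 : ∀ j, 0 < θ j) :
    ∃ φ : OpenPartialHomeomorph 𝔸 𝔸,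
      fr.point θ ∈ φ.source ∧ ContDiffOn ℝ ∞ φ φ.source ∧ ContDiffOn ℝ ∞ φ.symm φ.target ∧
      ∃ V : Submodule ℝ 𝔸, Module.finrank ℝ V =
        Module.finrank ℝ 𝔸 - Module.finrank ℝ fr.centralizer + m ∧
        φ '' (φ.source ∩ fr.stratum) = φ.target ∩ (V : Set 𝔸) := by
  have := FiniteDimensional.complete ℝ 𝔸
  obtain ⟨Zc, hZ⟩ := Submodule.exists_isCompl (Subalgebra.toSubmodule fr.centralizer)
  have hZ' := hZ
  rw [← fr.centralizer_point hθ h0] at hZ'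
  let F : Zc × (Fin m → ℝ) → 𝔸 := fun y =>
    (1 + (y.1 : 𝔸)) * (fr.point θ + fr.semis y.2) * Ring.inverse (1 + (y.1 : 𝔸))
  let ι : Zc × (Fin m → ℝ) →L[ℝ] 𝔸 := Zc.subtypeL.comp (ContinuousLinearMap.fst ℝ Zc (Fin m → ℝ))
  let sL : (Fin m → ℝ) →L[ℝ] 𝔸 :=
    ∑ j, (ContinuousLinearMap.proj (R := ℝ) (φ := fun _ : Fin m => ℝ) j).smulRight (fr.J j)
  have hsL (t : Fin m → ℝ) : sL t = fr.semis t := by simp [sL, semis]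
  let σ : Zc × (Fin m → ℝ) →L[ℝ] 𝔸 := sL.comp (ContinuousLinearMap.snd ℝ Zc (Fin m → ℝ))
  have hF : F = fun y => (1 + ι y) * (fr.point θ + σ y) * Ring.inverse (1 + ι y) := by
    funext y; simp [F, ι, σ, hsL]
  have hF0 : F 0 = fr.point θ := by simp [hF]
  have h1 : HasFDerivAt (fun y => 1 + ι y) ι 0 := ι.hasFDerivAt.const_add 1
  have h2 : HasFDerivAt (fun y => fr.point θ + σ y) σ 0 := σ.hasFDerivAt.const_add _
  have h3 : HasFDerivAt (fun y => Ring.inverse (1 + ι y)) (-ι) 0 := by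
    have h4 : HasFDerivAt Ring.inverse (-ContinuousLinearMap.mulLeftRight ℝ 𝔸 1 1) (1 + ι 0) := by
      simpa using hasFDerivAt_ringInverse (𝕜 := ℝ) (1 : 𝔸ˣ)
    have h5 : (-ContinuousLinearMap.mulLeftRight ℝ 𝔸 1 1).comp ι = -ι := by
      apply ContinuousLinearMap.ext
      intro y
      simp
    have h6 := h4.comp 0 h1
    rwa [h5] at h6
  have hFC : ContDiffAt ℝ ω F 0 := by
    rw [hF]
    have h4 : ContDiffAt ℝ ω Ring.inverse (1 + ι 0) := by
      simpa using contDiffAt_ringInverse ℝ (1 : 𝔸ˣ) (n := ω)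
    have h5 : ContDiff ℝ ω fun y => 1 + ι y := contDiff_const.add ι.contDiff
    have h6 : ContDiffAt ℝ ω (fun y => Ring.inverse (1 + ι y)) 0 :=
      ContDiffAt.comp (g := Ring.inverse) 0 h4 h5.contDiffAt
    exact (h5.mul (contDiff_const.add σ.contDiff)).contDiffAt.mul h6
  have hFD := (h1.mul' h2).mul' h3
  have hFD' := hFD.congr_of_eventuallyEq (f₁ := F) (Filter.EventuallyEq.of_eq hF)
  have hunit : ∀ᶠ x in 𝓝 (0 : 𝔸), IsUnit (1 + x) := by
    have h4 : Filter.Tendsto (fun x : 𝔸 => 1 + x) (𝓝 0) (𝓝 1) := by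
      have : Continuous fun x : 𝔸 => 1 + x := by fun_prop
      simpa using this.tendsto 0
    exact h4.eventually (Units.isOpen.mem_nhds isUnit_one)
  have hconj {x B z : 𝔸} (hx : IsUnit (1 + x)) (h : z * (1 + x) = (1 + x) * B) :
      z = (1 + x) * B * Ring.inverse (1 + x) := by
    rw [← h, mul_assoc, Ring.mul_inverse_cancel _ hx, mul_one]
  refine Exists.elim (exists_submanifold_chart (M := fr.stratum) hFC hFD' ?_ ?_ ?_) ?_
  · rw [injective_iff_map_eq_zero]
    intro y hy
    have hs0 : fr.semis 0 = 0 := by simp [semis]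
    have h4 : (y.1 : 𝔸) * fr.point θ - fr.point θ * y.1 + fr.semis y.2 = 0 := by
      change ι y * fr.point θ - fr.point θ * ι y + _ = _
      rw [← hy]
      simp [σ, hsL, hs0]
      abel
    have ht := fr.eq_zero_of_semis_eq_bracket h4
    rw [ht] at h4
    have h5 : (y.1 : 𝔸) * fr.point θ = fr.point θ * y.1 := by
      simpa [hs0, sub_eq_zero] using h4
    have h6 : (y.1 : 𝔸) = 0 := by
      refine hZ'.disjoint.le_bot ⟨?_, y.1.2⟩
      exact Subalgebra.mem_centralizer_iff ℝ |>.2 (by simpa using h5.symm)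
    exact Prod.ext (Subtype.ext h6) ht
  · have h4 : ∀ᶠ y : Zc × (Fin m → ℝ) in 𝓝 0, IsUnit (1 + (y.1 : 𝔸)) := by
      have : Filter.Tendsto (fun y : Zc × (Fin m → ℝ) => (y.1 : 𝔸)) (𝓝 0) (𝓝 0) := by
        have : Continuous fun y : Zc × (Fin m → ℝ) => (y.1 : 𝔸) := by fun_prop
        simpa using this.tendsto 0
      exact this.eventually hunit
    have h5 : ∀ᶠ y : Zc × (Fin m → ℝ) in 𝓝 0, (∀ i j, i < j → θ i + y.2 i < θ j + y.2 j) ∧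
        ∀ j, 0 < θ j + y.2 j := by
      refine Filter.Eventually.and (Filter.eventually_all.2 fun i => Filter.eventually_all.2
        fun j => Filter.eventually_all.2 fun hij => ?_) (Filter.eventually_all.2 fun j => ?_)
      · have hl : Continuous fun y : Zc × (Fin m → ℝ) => θ i + y.2 i := by fun_prop
        have hr : Continuous fun y : Zc × (Fin m → ℝ) => θ j + y.2 j := by fun_prop
        exact (hl.tendsto 0).eventually_lt (hr.tendsto 0) (by simpa using hθ hij)
      · have hr : Continuous fun y : Zc × (Fin m → ℝ) => θ j + y.2 j := by fun_prop
        exact (hr.tendsto 0).eventually (lt_mem_nhds (by simpa using h0 j))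
    filter_upwards [h4, h5] with y hu ht
    obtain ⟨u, hu⟩ := hu
    refine ⟨θ + y.2, fun i j hij => ht.1 i j hij, ht.2, u, ?_⟩
    simp only [F]
    rw [← hu, Ring.inverse_unit, point_add]
  · intro U hU
    rw [hF0]
    obtain ⟨ε, hε, hεU⟩ := Metric.mem_nhds_iff.1 hU
    obtain ⟨ρ, hρ, hρu⟩ := Metric.mem_nhds_iff.1 hunit
    obtain ⟨η, hη, hnear⟩ := exists_conj_near_one hZ' (lt_min hε hρ)
    obtain ⟨κ, hκ, hκη⟩ : ∃ κ > 0, ∀ t : Fin m → ℝ, ‖t‖ < κ → ‖fr.semis t‖ < η := by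
      have h4 : Filter.Tendsto sL (𝓝 0) (𝓝 0) := by simpa using sL.continuous.tendsto 0
      obtain ⟨κ, hκ, hκη⟩ := Metric.tendsto_nhds_nhds.1 h4 η hη
      exact ⟨κ, hκ, fun t ht => by simpa [hsL] using hκη (x := t) (by simpa using ht)⟩
    filter_upwards [fr.eventually_abs_sub_lt hθ h0 (lt_min hε hκ), Metric.ball_mem_nhds _ hη]
      with z hz hzη hzM
    obtain ⟨θ', hθ', h0', C, hC⟩ := hzM
    have ht := hz θ' hθ' h0' C hC
    have ht' : ‖θ' - θ‖ < min ε κ := by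
      rw [pi_norm_lt_iff (lt_min hε hκ)]
      exact fun j => ht j
    have hpt : fr.point θ' = fr.point θ + fr.semis (θ' - θ) := by
      rw [← point_add, add_sub_cancel]
    obtain ⟨X, hXZ, hXε, hX⟩ := hnear (fr.point θ') z C hC
      (by rw [hpt, add_sub_cancel_left]; exact hκη _ (ht'.trans_le (min_le_right _ _)))
      (by simpa [dist_eq_norm] using hzη)
      (by rw [fr.centralizer_point hθ' h0', fr.centralizer_point hθ h0])
    refine ⟨(⟨X, hXZ⟩, θ' - θ), hεU ?_, ?_⟩
    · rw [mem_ball_zero_iff, Prod.norm_def, max_lt_iff]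
      exact ⟨hXε.trans_le (min_le_left _ _), ht'.trans_le (min_le_left _ _)⟩
    · have hu : IsUnit (1 + X) := hρu (by simpa using hXε.trans_le (min_le_right _ _))
      simp only [F]
      rw [← hpt, ← hconj hu hX]
  · rintro φ ⟨hφ1, hφ2, hφ3, V, hV, hφV⟩
    rw [hF0] at hφ1
    refine ⟨φ, hφ1, hφ2, hφ3, V, ?_, hφV⟩
    rw [hV, Module.finrank_prod, Module.finrank_fin_fun, ← Submodule.finrank_add_eq_of_isCompl hZ]
    simp

theorem finrank_centralizer_map {𝔸 𝔹 : Type*} [Ring 𝔸] [Algebra ℝ 𝔸] [Ring 𝔹] [Algebra ℝ 𝔹]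
    (fr : ImagFrame 𝔸 m) (e : 𝔸 ≃ₐ[ℝ] 𝔹) :
    Module.finrank ℝ (fr.map e).centralizer = Module.finrank ℝ fr.centralizer := by
  have h : Subalgebra.toSubmodule (fr.map e).centralizer =
      (Subalgebra.toSubmodule fr.centralizer).map (e.toLinearEquiv : 𝔸 →ₗ[ℝ] 𝔹) := by
    ext y
    obtain ⟨x, rfl⟩ := e.surjective y
    have h1 : e x ∈ (fr.map e).centralizer ↔ x ∈ fr.centralizer := by
      simp only [mem_centralizer_iff, map, Commute, SemiconjBy, ← map_mul, e.injective.eq_iff]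
    rw [Subalgebra.mem_toSubmodule, h1, Submodule.mem_map]
    constructor
    · exact fun h => ⟨x, h, rfl⟩
    · rintro ⟨x', hx', h⟩
      rwa [← e.injective h]
  exact (congrArg (fun p : Submodule ℝ 𝔹 => Module.finrank ℝ p) h).trans
    (LinearEquiv.finrank_map_eq e.toLinearEquiv _)

theorem isEmbeddedSubmanifold_stratum :
    IsEmbeddedSubmanifold (Module.finrank ℝ 𝔸 - Module.finrank ℝ fr.centralizer + m)
      fr.stratum := by
  rintro A ⟨θ, hθ, h0, C, rfl⟩
  have := (fr.map (conjEquiv C)).exists_chart_point hθ h0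
  rwa [stratum_map_conjEquiv, finrank_centralizer_map, map_point, conjEquiv_apply] at this

end ImagFrame

/-! ### Every matrix with imaginary spectrum lies in a stratum -/

/-- Cayley–Hamilton: over `ℂ` the characteristic polynomial splits into linear factors each dividing
`p`, so it divides the given power of `p`. -/
theorem Matrix.aeval_pow_card_eq_zero {ι : Type*} [Fintype ι] [DecidableEq ι]
    {M : Matrix ι ι ℝ} {p : ℝ[X]}
    (h : ∀ z : ℂ, (M.map (algebraMap ℝ ℂ)).charpoly.IsRoot z → aeval z p = 0) :
    (aeval M p) ^ Fintype.card ι = 0 := by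
  set χ := (M.map (algebraMap ℝ ℂ)).charpoly with hχ
  have hmon : χ.Monic := Matrix.charpoly_monic _
  have key (s : Multiset ℂ) (hs : ∀ z ∈ s, aeval z p = 0) :
      (s.map fun z => X - C z).prod ∣ p.map (algebraMap ℝ ℂ) ^ s.card := by
    induction s using Multiset.induction_on with
    | empty => simp
    | cons a s ih =>
      rw [Multiset.map_cons, Multiset.prod_cons, Multiset.card_cons, pow_succ']
      refine mul_dvd_mul ?_ (ih fun z hz => hs z (Multiset.mem_cons_of_mem hz))
      rw [dvd_iff_isRoot, IsRoot, eval_map_algebraMap]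
      exact hs a (Multiset.mem_cons_self a s)
  have h1 : χ ∣ p.map (algebraMap ℝ ℂ) ^ Fintype.card ι := by
    have h2 := key χ.roots fun z hz => h z ((mem_roots hmon.ne_zero).1 hz)
    rwa [← (IsAlgClosed.splits χ).eq_prod_roots_of_monic hmon,
      ← (IsAlgClosed.splits χ).natDegree_eq_card_roots, hχ, Matrix.charpoly_natDegree_eq_dim] at h2
  have h2 : aeval (M.map (algebraMap ℝ ℂ)) (p.map (algebraMap ℝ ℂ) ^ Fintype.card ι) = 0 := by
    obtain ⟨q, hq⟩ := h1
    rw [hq, map_mul, hχ, Matrix.aeval_self_charpoly, zero_mul]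
  rw [← Polynomial.map_pow, aeval_map_algebraMap] at h2
  have h3 := aeval_algHom_apply (Algebra.ofId ℝ ℂ).mapMatrix M (p ^ Fintype.card ι)
  have h4 : (Algebra.ofId ℝ ℂ).mapMatrix (aeval M (p ^ Fintype.card ι)) = 0 := h3.symm.trans h2
  rw [← map_pow]
  ext i j
  have h5 := congrFun (congrFun h4 i) j
  exact (map_eq_zero_iff (algebraMap ℝ ℂ) (algebraMap ℝ ℂ).injective).1 h5

section Roots

variable {m : ℕ} {θ : Fin m → ℝ}

theorem aeval_complex_imagPoly_eq_zero_iff {z : ℂ} :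
    aeval z (imagPoly θ) = 0 ↔ z = 0 ∨ ∃ j, z ^ 2 + (θ j : ℂ) ^ 2 = 0 := by
  rw [imagPoly_eq_prod, map_mul, aeval_X, mul_eq_zero, map_prod, Finset.prod_eq_zero_iff, or_comm]
  simp

theorem re_eq_zero_of_aeval_imagPoly {z : ℂ} (hz : aeval z (imagPoly θ) = 0) : z.re = 0 := by
  rw [aeval_complex_imagPoly_eq_zero_iff] at hz
  rcases hz with rfl | ⟨j, hj⟩
  · rfl
  · have h1 : (z - θ j * Complex.I) * (z + θ j * Complex.I) = 0 := by
      rw [← hj]; linear_combination -(θ j : ℂ) ^ 2 * Complex.I_sq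
    rcases mul_eq_zero.1 h1 with h | h
    · rw [sub_eq_zero.1 h]; simp
    · rw [eq_neg_of_add_eq_zero_left h]; simp

end Roots

section Matrices

variable {n m : ℕ}

theorem hasPurelyImaginarySpectrum_iff {A : Matrix (Fin n) (Fin n) ℝ} :
    HasPurelyImaginarySpectrum A ↔
      ∀ z : ℂ, (A.map (algebraMap ℝ ℂ)).charpoly.IsRoot z → z.re = 0 := by
  simp only [HasPurelyImaginarySpectrum, Matrix.mem_spectrum_iff_isRoot_charpoly, complexify]

namespace ImagFrame

variable (fr : ImagFrame (Matrix (Fin n) (Fin n) ℝ) m)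

theorem isNilpotent_aeval_of_mem {A : Matrix (Fin n) (Fin n) ℝ} {θ : Fin m → ℝ}
    {C : (Matrix (Fin n) (Fin n) ℝ)ˣ} (hA : A = C * fr.point θ * (C⁻¹ : (Matrix _ _ ℝ)ˣ)) :
    IsNilpotent (aeval A (imagPoly θ)) := by
  have h := (fr.map (conjEquiv C)).isNilpotent_aeval_point θ
  rwa [map_point, conjEquiv_apply, ← hA] at h

theorem hasPurelyImaginarySpectrum_of_mem {A : Matrix (Fin n) (Fin n) ℝ} (hA : A ∈ fr.stratum) :
    HasPurelyImaginarySpectrum A := by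
  obtain ⟨θ, -, -, C, hC⟩ := hA
  rw [hasPurelyImaginarySpectrum_iff]
  intro z hz
  exact re_eq_zero_of_aeval_imagPoly
    (Matrix.aeval_eq_zero_of_isRoot_charpoly_map (fr.isNilpotent_aeval_of_mem hC) hz)

theorem isEmbeddedSubmanifold_stratum_matrix :
    IsEmbeddedSubmanifold (n ^ 2 - Module.finrank ℝ fr.centralizer + m) fr.stratum := by
  -- The entrywise norm is not submultiplicative, so the chart is built in the normed algebra of
  -- continuous endomorphisms and transported back linearly.
  let e : Matrix (Fin n) (Fin n) ℝ ≃ₐ[ℝ] ((Fin n → ℝ) →L[ℝ] (Fin n → ℝ)) :=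
    Matrix.toLinAlgEquiv'.trans (Module.End.toContinuousLinearMap (Fin n → ℝ))
  let e' : ((Fin n → ℝ) →L[ℝ] (Fin n → ℝ)) ≃L[ℝ] Matrix (Fin n) (Fin n) ℝ :=
    e.symm.toLinearEquiv.toContinuousLinearEquiv
  have h : IsEmbeddedSubmanifold _ ((fun x => e.symm x) '' (fr.map e).stratum) :=
    (fr.map e).isEmbeddedSubmanifold_stratum.image e'
  have h1 : (fun x => e.symm x) '' (fr.map e).stratum = fr.stratum := by
    rw [map_stratum, Set.image_image]
    convert Set.image_id fr.stratum using 1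
    exact Set.image_congr fun x _ => e.symm_apply_apply x
  have h2 : Module.finrank ℝ ((Fin n → ℝ) →L[ℝ] (Fin n → ℝ)) = n ^ 2 := by
    rw [← e.toLinearEquiv.finrank_eq, Module.finrank_matrix]
    simp [sq]
  rwa [h1, h2, finrank_centralizer_map] at h

end ImagFrame

/-- The frequencies are the positive imaginary parts of the eigenvalues. Eigenvalues come in
conjugate pairs, so `imagPoly θ` vanishes on the whole spectrum and its value at `A` is nilpotent;
Jordan–Chevalley then supplies the frame. -/
theorem exists_frame_of_hasPurelyImaginarySpectrum {A : Matrix (Fin n) (Fin n) ℝ}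
    (hA : HasPurelyImaginarySpectrum A) :
    ∃ (m : ℕ) (fr : ImagFrame (Matrix (Fin n) (Fin n) ℝ) m), A ∈ fr.stratum := by
  rw [hasPurelyImaginarySpectrum_iff] at hA
  set χ := (A.map (algebraMap ℝ ℂ)).charpoly with hχ
  have hmon : χ.Monic := Matrix.charpoly_monic _
  have hχA : χ = A.charpoly.map (algebraMap ℝ ℂ) := by rw [hχ, Matrix.charpoly_map]
  let Ω : Finset ℝ := (χ.roots.toFinset.image Complex.im).filter fun y => 0 < y
  have hΩ {y : ℝ} : y ∈ Ω ↔ 0 < y ∧ χ.IsRoot (y * Complex.I) := by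
    simp only [Ω, Finset.mem_filter, Finset.mem_image, Multiset.mem_toFinset,
      mem_roots hmon.ne_zero, and_comm]
    refine and_congr_right fun _ => ⟨?_, fun h => ⟨_, by simp, h⟩⟩
    rintro ⟨z, rfl, hz⟩
    have h1 : z = z.im * Complex.I := by
      apply Complex.ext <;> simp [hA z hz]
    rwa [← h1]
  set θ : Fin Ω.card → ℝ := fun j => Ω.orderEmbOfFin rfl j with hθdef
  have hθ : StrictMono θ := (Ω.orderEmbOfFin rfl).strictMono
  have hrange : Set.range θ = Ω := Finset.range_orderEmbOfFin Ω rfl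
  have hmem (j) : θ j ∈ Ω := by
    rw [← Finset.mem_coe, ← hrange]; exact ⟨j, rfl⟩
  have h0 : ∀ j, 0 < θ j := fun j => (hΩ.1 (hmem j)).1
  have hroot : ∀ z : ℂ, χ.IsRoot z → aeval z (imagPoly θ) = 0 := by
    intro z hz
    rw [aeval_complex_imagPoly_eq_zero_iff]
    have hz' : z = z.im * Complex.I := by
      apply Complex.ext <;> simp [hA z hz]
    have hpos {y : ℝ} (hy : 0 < y) (hy' : χ.IsRoot (y * Complex.I)) (hzy : z.im ^ 2 = y ^ 2) :
        ∃ j, z ^ 2 + (θ j : ℂ) ^ 2 = 0 := by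
      obtain ⟨j, hj⟩ : y ∈ Set.range θ := by rw [hrange]; exact hΩ.2 ⟨hy, hy'⟩
      refine ⟨j, ?_⟩
      rw [hj, hz', mul_pow, Complex.I_sq, ← Complex.ofReal_pow, ← Complex.ofReal_pow, hzy]
      ring
    rcases lt_trichotomy z.im 0 with h | h | h
    · refine Or.inr (hpos (y := -z.im) (by linarith) ?_ (by ring))
      have h1 : χ.IsRoot ((starRingEnd ℂ) z) := by
        rw [IsRoot, hχA, eval_map_algebraMap] at hz ⊢
        rw [aeval_conj, hz, map_zero]
      convert h1 using 1
      apply Complex.ext <;> simp [hA z hz]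
    · left
      rw [hz', h]; simp
    · exact Or.inr (hpos h (hz' ▸ hz) rfl)
  have hnil : IsNilpotent (aeval A (imagPoly θ)) := ⟨_, Matrix.aeval_pow_card_eq_zero hroot⟩
  obtain ⟨S, hS, hn, hz⟩ := exists_mem_adjoin_isNilpotent_sub hnil (imagPoly_separable hθ h0)
  have hSA : Commute S A :=
    (Algebra.commute_of_mem_adjoin_singleton_of_commute hS (Commute.refl A)).symm
  obtain ⟨fr, hfr⟩ := ImagFrame.exists_point_eq (S := S) (N := A - S)
    (hSA.sub_right (Commute.refl S)) hn hθ h0 hz (by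
      -- By spectral mapping `A ^ 2 + θ j ^ 2` is singular over `ℂ`, because `i θ j` is an
      -- eigenvalue; a real inverse would remain one over `ℂ`.
      intro j hu
      rw [add_sub_cancel] at hu
      have h1 := (hΩ.1 (hmem j)).2
      rw [← Matrix.mem_spectrum_iff_isRoot_charpoly] at h1
      have h2 := spectrum.subset_polynomial_aeval (A.map (algebraMap ℝ ℂ))
        (X ^ 2 + C ((θ j : ℂ) ^ 2)) ⟨_, h1, rfl⟩
      have h3 : eval ((θ j : ℂ) * Complex.I) (X ^ 2 + C ((θ j : ℂ) ^ 2)) = 0 := by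
        simp [mul_pow]
      simp only [h3] at h2
      rw [spectrum.zero_mem_iff] at h2
      apply h2
      have h4 := hu.map (Algebra.ofId ℝ ℂ).mapMatrix
      convert h4 using 1
      rw [map_add, map_pow, aeval_X, aeval_C, map_add, map_pow, AlgHom.commutes]
      congr 1
      · rw [map_pow]; rfl
      · rw [IsScalarTower.algebraMap_apply ℝ ℂ]
        simp)
  refine ⟨_, fr, ?_⟩
  have := fr.point_mem_stratum hθ h0
  rwa [hfr, add_sub_cancel] at this

end Matrices

/-! ### Finiteness up to conjugacy, through `ℝ[X]`-modules -/

section PolynomialModules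

variable {R : Type*} [CommRing R]

/-- Zero factors can be dropped or inserted, which lets a cyclic decomposition be indexed by a
prescribed finite type. -/
theorem exists_piQuotient_equiv_comp {ι κ : Type*} [Fintype κ] {f : κ → ι}
    (hf : Function.Injective f) (I : ι → Ideal R) (hI : ∀ i ∉ Set.range f, I i = ⊤) :
    Nonempty ((∀ i, R ⧸ I i) ≃ₗ[R] ∀ k, R ⧸ I (f k)) := by
  classical
  refine ⟨LinearEquiv.ofBijective
    (LinearMap.pi fun k => LinearMap.proj (R := R) (φ := fun i => R ⧸ I i) (f k)) ⟨?_, ?_⟩⟩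
  · rw [injective_iff_map_eq_zero]
    intro x hx
    funext i
    by_cases hi : i ∈ Set.range f
    · obtain ⟨k, rfl⟩ := hi
      exact congrFun hx k
    · have : Subsingleton (R ⧸ I i) := Ideal.Quotient.subsingleton_iff.2 (hI i hi)
      exact Subsingleton.elim _ _
  · intro y
    refine ⟨∑ k, Pi.single (f k) (y k), ?_⟩
    funext k
    simp only [LinearMap.pi_apply, LinearMap.proj_apply, Finset.sum_apply]
    rw [Finset.sum_eq_single k]
    · simp
    · intro k' _ hk'
      exact Pi.single_eq_of_ne (fun h => hk' (hf h).symm) _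
    · simp

/-- For ideals here, to contain is to divide, and the nonzero ideal `(F)` has finitely many
divisors. -/
theorem finite_setOf_mem_ideal [IsDomain R] [IsPrincipalIdealRing R] {F : R} (hF : F ≠ 0) :
    Finite {I : Ideal R // F ∈ I} := by
  have := UniqueFactorizationMonoid.fintypeSubtypeDvd (Ideal.span {F}) (by simpa using hF)
  refine Finite.of_injective
    (fun I : {I : Ideal R // F ∈ I} => (⟨I.1, by simpa using I.2⟩ : {J // J ∣ Ideal.span {F}})) ?_
  intro I J h
  exact Subtype.ext (congrArg (fun K : {J // J ∣ Ideal.span {F}} => K.1) h)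

end PolynomialModules

namespace Matrix

variable {n : ℕ}

/-- The `ℝ[X]`-module structure on `ℝⁿ` given by a matrix. -/
abbrev PolyModule (A : Matrix (Fin n) (Fin n) ℝ) : Type := Module.AEval' (Matrix.toLin' A)

/-- An `ℝ[X]`-linear isomorphism intertwines the two actions of `X`, that is, the two matrices. -/
theorem exists_conj_of_polyModule_equiv {A B : Matrix (Fin n) (Fin n) ℝ}
    (e : PolyModule A ≃ₗ[ℝ[X]] PolyModule B) :
    ∃ C : (Matrix (Fin n) (Fin n) ℝ)ˣ, B = C * A * (C⁻¹ : (Matrix (Fin n) (Fin n) ℝ)ˣ) := by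
  let f : (Fin n → ℝ) ≃ₗ[ℝ] (Fin n → ℝ) :=
    ((Module.AEval'.of (Matrix.toLin' A)).trans (e.restrictScalars ℝ)).trans
      (Module.AEval'.of (Matrix.toLin' B)).symm
  have hf (v : Fin n → ℝ) : f (A.mulVec v) = B.mulVec (f v) := by
    have h1 : e ((X : ℝ[X]) • Module.AEval'.of (Matrix.toLin' A) v) =
        (X : ℝ[X]) • e (Module.AEval'.of (Matrix.toLin' A) v) := map_smul _ _ _
    have h2 := congrArg (Module.AEval'.of (Matrix.toLin' B)).symm h1
    rw [Module.AEval.X_smul_of, Module.AEval.of_symm_X_smul] at h2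
    exact h2
  refine ⟨⟨LinearMap.toMatrix' f, LinearMap.toMatrix' f.symm, ?_, ?_⟩, ?_⟩
  · rw [← LinearMap.toMatrix'_comp]; simp
  · rw [← LinearMap.toMatrix'_comp]; simp
  · have h1 : B * LinearMap.toMatrix' (f : (Fin n → ℝ) →ₗ[ℝ] (Fin n → ℝ)) =
        LinearMap.toMatrix' (f : (Fin n → ℝ) →ₗ[ℝ] (Fin n → ℝ)) * A := by
      apply Matrix.toLin'.injective
      rw [Matrix.toLin'_mul, Matrix.toLin'_mul, Matrix.toLin'_toMatrix']
      exact LinearMap.ext fun v => (hf v).symm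
    have h2 : LinearMap.toMatrix' (f : (Fin n → ℝ) →ₗ[ℝ] (Fin n → ℝ)) *
        LinearMap.toMatrix' (f.symm : (Fin n → ℝ) →ₗ[ℝ] (Fin n → ℝ)) = 1 := by
      rw [← LinearMap.toMatrix'_comp]; simp
    change B = _ * A * LinearMap.toMatrix' (f.symm : (Fin n → ℝ) →ₗ[ℝ] (Fin n → ℝ))
    change B = LinearMap.toMatrix' (f : (Fin n → ℝ) →ₗ[ℝ] (Fin n → ℝ)) * A * _
    rw [← h1, mul_assoc, h2, mul_one]

theorem exists_polyModule_equiv_pi (A : Matrix (Fin n) (Fin n) ℝ) :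
    ∃ (ι : Type) (_ : Fintype ι) (I : ι → Ideal ℝ[X]),
      Nonempty (PolyModule A ≃ₗ[ℝ[X]] ∀ i, ℝ[X] ⧸ I i) := by
  classical
  obtain ⟨ι, hι, p, -, e, ⟨f⟩⟩ := Module.equiv_directSum_of_isTorsion
    (Module.AEval.isTorsion_of_finiteDimensional ℝ (Fin n → ℝ) (Matrix.toLin' A))
  exact ⟨ι, hι, fun i => Ideal.span {p i ^ e i},
    ⟨f.trans (DirectSum.linearEquivFunOnFintype ℝ[X] ι fun i => ℝ[X] ⧸ Ideal.span {p i ^ e i})⟩⟩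

/-- Each nonzero cyclic summand contributes at least one dimension, so at most `n` of them occur;
padding with the unit ideal gives the fixed index type `Fin n`, hence only finitely many possible
tuples. -/
theorem exists_polyModule_equiv_fin (A : Matrix (Fin n) (Fin n) ℝ) {F : ℝ[X]}
    (hF : aeval A F = 0) :
    ∃ I : Fin n → {I : Ideal ℝ[X] // F ∈ I},
      Nonempty (PolyModule A ≃ₗ[ℝ[X]] ∀ i, ℝ[X] ⧸ (I i : Ideal ℝ[X])) := by
  classical
  obtain ⟨ι, _, I, ⟨e⟩⟩ := A.exists_polyModule_equiv_pi
  have hFI (i : ι) : F ∈ I i := by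
    have h1 : F • e.symm 1 = 0 := by
      have h2 : aeval (Matrix.toLin' A) F = 0 := by
        have := aeval_algHom_apply (Matrix.toLinAlgEquiv' (R := ℝ) (n := Fin n)) A F
        rw [hF, map_zero] at this
        exact this
      apply (Module.AEval'.of (Matrix.toLin' A)).symm.injective
      rw [Module.AEval.of_symm_smul, h2, map_zero, zero_smul]
    have h2 : F • (1 : ∀ i, ℝ[X] ⧸ I i) = 0 := by
      rw [← e.apply_symm_apply 1, ← map_smul, h1, map_zero]
    have h3 : Ideal.Quotient.mk (I i) (F * 1) = 0 := congrFun h2 i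
    rw [mul_one] at h3
    exact Ideal.Quotient.eq_zero_iff_mem.1 h3
  let κ := {i : ι // I i ≠ ⊤}
  let eV : (Fin n → ℝ) ≃ₗ[ℝ] ∀ i, ℝ[X] ⧸ I i :=
    (Module.AEval'.of (Matrix.toLin' A)).trans (e.restrictScalars ℝ)
  have hcard : Fintype.card κ ≤ n := by
    have hfin : FiniteDimensional ℝ (∀ i, ℝ[X] ⧸ I i) := eV.finiteDimensional
    have hli : LinearIndependent ℝ fun k : κ => (Pi.single k.1 1 : ∀ i, ℝ[X] ⧸ I i) := by
      rw [Fintype.linearIndependent_iff]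
      intro c hc k
      have h1 := congrFun hc k.1
      rw [Finset.sum_apply, Finset.sum_eq_single k] at h1
      · have : Nontrivial (ℝ[X] ⧸ I k.1) := Ideal.Quotient.nontrivial_iff.2 k.2
        simpa using h1
      · intro k' _ hk'
        rw [Pi.smul_apply, Pi.single_eq_of_ne (fun h => hk' (Subtype.ext h.symm)), smul_zero]
      · simp
    have := hli.fintype_card_le_finrank
    rwa [← eV.finrank_eq, Module.finrank_fin_fun] at this
  obtain ⟨f⟩ : Nonempty (κ ↪ Fin n) :=
    Function.Embedding.nonempty_of_card_le (by simpa using hcard)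
  let I' : Fin n → Ideal ℝ[X] := Function.extend f (fun k : κ => I k.1) fun _ => ⊤
  have hI'f (k : κ) : I' (f k) = I k.1 := f.injective.extend_apply _ _ k
  have hI'top (i : Fin n) (hi : i ∉ Set.range f) : I' i = ⊤ :=
    Function.extend_apply' _ _ _ fun ⟨k, hk⟩ => hi ⟨k, hk⟩
  have hFI' (i : Fin n) : F ∈ I' i := by
    by_cases hi : i ∈ Set.range f
    · obtain ⟨k, rfl⟩ := hi
      rw [hI'f]; exact hFI k.1
    · rw [hI'top i hi]; trivial
  obtain ⟨e₁⟩ := exists_piQuotient_equiv_comp (Subtype.val_injective (p := fun i => I i ≠ ⊤)) I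
    (fun i hi => by by_contra h; exact hi ⟨⟨i, h⟩, rfl⟩)
  obtain ⟨e₂⟩ := exists_piQuotient_equiv_comp f.injective I' hI'top
  exact ⟨fun i => ⟨I' i, hFI' i⟩, ⟨(e.trans e₁).trans
    ((LinearEquiv.piCongrRight fun k => Submodule.quotEquivOfEq _ _ (hI'f k).symm).trans e₂.symm)⟩⟩

/-- Up to conjugation there are finitely many matrices annihilated by a given polynomial. -/
theorem exists_finite_conj_representatives {F : ℝ[X]} (hF : F ≠ 0) :
    ∃ T : Set (Matrix (Fin n) (Fin n) ℝ), T.Finite ∧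
      ∀ A : Matrix (Fin n) (Fin n) ℝ, aeval A F = 0 →
        ∃ C : (Matrix (Fin n) (Fin n) ℝ)ˣ, C * A * (C⁻¹ : (Matrix (Fin n) (Fin n) ℝ)ˣ) ∈ T := by
  classical
  have := finite_setOf_mem_ideal hF
  -- Tuples of ideals that no matrix realizes get the irrelevant value `0`.
  let rep : (Fin n → {I : Ideal ℝ[X] // F ∈ I}) → Matrix (Fin n) (Fin n) ℝ := fun I =>
    if h : ∃ A : Matrix (Fin n) (Fin n) ℝ,
      Nonempty (PolyModule A ≃ₗ[ℝ[X]] ∀ i, ℝ[X] ⧸ (I i : Ideal ℝ[X])) then h.choose else 0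
  refine ⟨Set.range rep, Set.finite_range rep, fun A hA => ?_⟩
  obtain ⟨I, ⟨e⟩⟩ := A.exists_polyModule_equiv_fin hA
  have h : ∃ A : Matrix (Fin n) (Fin n) ℝ,
      Nonempty (PolyModule A ≃ₗ[ℝ[X]] ∀ i, ℝ[X] ⧸ (I i : Ideal ℝ[X])) := ⟨A, ⟨e⟩⟩
  obtain ⟨e'⟩ := h.choose_spec
  obtain ⟨C, hC⟩ := exists_conj_of_polyModule_equiv (e.trans e'.symm)
  refine ⟨C, I, ?_⟩
  rw [← hC]
  exact dif_pos h

/-! ### Centralizers and cyclic matrices -/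

theorem mem_centralizer_singleton_iff {A B : Matrix (Fin n) (Fin n) ℝ} :
    B ∈ Subalgebra.centralizer ℝ {A} ↔ A * B = B * A := by
  simp [Subalgebra.mem_centralizer_iff]

/-- A cyclic decomposition identifies `ℝⁿ` with a product of quotient rings of `ℝ[X]`.
Multiplications in this commutative ring commute with that by `X`, and they are distinguished by
their value at `1`, so they form an `n`-dimensional space in the centralizer. -/
theorem le_finrank_centralizer (A : Matrix (Fin n) (Fin n) ℝ) :
    n ≤ Module.finrank ℝ (Subalgebra.centralizer ℝ {A}) := by
  obtain ⟨ι, _, I, ⟨e⟩⟩ := A.exists_polyModule_equiv_pi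
  let eV : (Fin n → ℝ) ≃ₗ[ℝ] ∀ i, ℝ[X] ⧸ I i :=
    (Module.AEval'.of (Matrix.toLin' A)).trans (e.restrictScalars ℝ)
  have heV (v : Fin n → ℝ) : eV (A.mulVec v) = (X : ℝ[X]) • eV v := by
    change e (Module.AEval'.of (Matrix.toLin' A) (Matrix.toLin' A • v)) = _
    rw [← Module.AEval.X_smul_of, map_smul]
    rfl
  have heV' (x : ∀ i, ℝ[X] ⧸ I i) : A.mulVec (eV.symm x) = eV.symm ((X : ℝ[X]) • x) := by
    rw [eV.eq_symm_apply, heV, eV.apply_symm_apply]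
  let Φ : (Fin n → ℝ) →ₗ[ℝ] Matrix (Fin n) (Fin n) ℝ :=
    LinearMap.toMatrix'.toLinearMap ∘ₗ
      (eV.symm.conj.toLinearMap ∘ₗ LinearMap.mul ℝ (∀ i, ℝ[X] ⧸ I i) ∘ₗ eV.toLinearMap)
  have hΦ (v w : Fin n → ℝ) : (Φ v).mulVec w = eV.symm (eV v * eV w) := by
    change (LinearMap.toMatrix' (eV.symm.conj (LinearMap.mul ℝ _ (eV v)))).mulVec w = _
    rw [LinearMap.toMatrix'_mulVec]
    rfl
  have hcent (v : Fin n → ℝ) : Φ v ∈ Subalgebra.toSubmodule (Subalgebra.centralizer ℝ {A}) := by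
    rw [Subalgebra.mem_toSubmodule, mem_centralizer_singleton_iff]
    apply Matrix.toLin'.injective
    ext1 w
    ext1
    simp only [LinearMap.comp_apply, Matrix.toLin'_mul, Matrix.toLin'_apply]
    rw [hΦ, hΦ, heV', heV, mul_smul_comm]
  have hinj : Function.Injective (Φ.codRestrict _ hcent) := by
    rw [injective_iff_map_eq_zero]
    intro v hv
    have h1 : Φ v = 0 := congrArg Subtype.val hv
    have h2 := hΦ v (eV.symm 1)
    rw [h1, Matrix.zero_mulVec, eV.apply_symm_apply, mul_one, eV.symm_apply_apply] at h2
    exact h2.symm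
  have := LinearMap.finrank_le_finrank_of_injective hinj
  rwa [Module.finrank_fin_fun] at this

/-- Some vector has the same annihilator as the whole module; the submodule it generates then has
dimension `n` and is everything. -/
theorem exists_cyclic_vector {A : Matrix (Fin n) (Fin n) ℝ} (hA : (minpoly ℝ A).natDegree = n) :
    ∃ v : PolyModule A, Function.Surjective (LinearMap.toSpanSingleton ℝ[X] _ v) ∧
      LinearMap.ker (LinearMap.toSpanSingleton ℝ[X] _ v) = Ideal.span {minpoly ℝ A} := by
  obtain ⟨v, hv⟩ := Module.exists_ker_toSpanSingleton_eq_annihilator ℝ[X] (PolyModule A)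
  rw [Module.AEval.annihilator_eq_ker_aeval, minpoly.ker_aeval_eq_span_minpoly,
    Matrix.minpoly_toLin'] at hv
  refine ⟨v, ?_, hv⟩
  let f : (ℝ[X] ⧸ Ideal.span {minpoly ℝ A}) →ₗ[ℝ[X]] PolyModule A :=
    Submodule.liftQ _ (LinearMap.toSpanSingleton ℝ[X] _ v) hv.ge
  have hf : Function.Injective (f.restrictScalars ℝ) := by
    change Function.Injective f
    rw [← LinearMap.ker_eq_bot, Submodule.ker_liftQ_eq_bot _ _ _ hv.le]
  have hne : minpoly ℝ A ≠ 0 := minpoly.ne_zero (Algebra.IsIntegral.isIntegral A)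
  have hdim : Module.finrank ℝ (ℝ[X] ⧸ Ideal.span {minpoly ℝ A}) =
      Module.finrank ℝ (PolyModule A) := by
    rw [finrank_quotient_span_eq_natDegree, hA,
      ← (Module.AEval'.of (Matrix.toLin' A)).finrank_eq, Module.finrank_fin_fun]
  have : FiniteDimensional ℝ (ℝ[X] ⧸ Ideal.span {minpoly ℝ A}) :=
    (AdjoinRoot.powerBasis hne).finite
  have hs : Function.Surjective f :=
    (LinearMap.injective_iff_surjective_of_finrank_eq_finrank hdim).1 hf
  intro w
  obtain ⟨x, rfl⟩ := hs w
  obtain ⟨p, rfl⟩ := Submodule.Quotient.mk_surjective _ x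
  exact ⟨p, rfl⟩

theorem exists_conj_of_minpoly_eq {A B : Matrix (Fin n) (Fin n) ℝ}
    (hA : (minpoly ℝ A).natDegree = n) (h : minpoly ℝ A = minpoly ℝ B) :
    ∃ C : (Matrix (Fin n) (Fin n) ℝ)ˣ, B = C * A * (C⁻¹ : (Matrix (Fin n) (Fin n) ℝ)ˣ) := by
  obtain ⟨v, hv, hkv⟩ := exists_cyclic_vector hA
  obtain ⟨w, hw, hkw⟩ := exists_cyclic_vector (h ▸ hA)
  exact exists_conj_of_polyModule_equiv (((LinearMap.quotKerEquivOfSurjective _ hv).symm.trans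
    (Submodule.quotEquivOfEq _ _ (by rw [hkv, hkw, h]))).trans
      (LinearMap.quotKerEquivOfSurjective _ hw))

/-- A matrix commuting with `A` is determined by its value at a cyclic vector, so the general lower
bound `n` is attained. -/
theorem finrank_centralizer_of_cyclic {A : Matrix (Fin n) (Fin n) ℝ}
    (hA : (minpoly ℝ A).natDegree = n) :
    Module.finrank ℝ (Subalgebra.centralizer ℝ {A}) = n := by
  refine le_antisymm ?_ A.le_finrank_centralizer
  obtain ⟨v, hv, -⟩ := exists_cyclic_vector hA
  let v' : Fin n → ℝ := (Module.AEval'.of (Matrix.toLin' A)).symm v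
  have hspan (w : Fin n → ℝ) : ∃ p : ℝ[X], (aeval A p).mulVec v' = w := by
    obtain ⟨p, hp⟩ := hv (Module.AEval'.of (Matrix.toLin' A) w)
    refine ⟨p, ?_⟩
    have h1 := congrArg (Module.AEval'.of (Matrix.toLin' A)).symm hp
    rw [LinearMap.toSpanSingleton_apply, Module.AEval.of_symm_smul,
      LinearEquiv.symm_apply_apply] at h1
    rw [← h1]
    have h2 := aeval_algHom_apply (Matrix.toLinAlgEquiv' (R := ℝ) (n := Fin n)) A p
    exact (LinearMap.congr_fun h2 v').symm
  let ev : Subalgebra.centralizer ℝ {A} →ₗ[ℝ] (Fin n → ℝ) :=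
    (LinearMap.applyₗ v' ∘ₗ Matrix.toLin'.toLinearMap) ∘ₗ
      (Subalgebra.centralizer ℝ {A}).val.toLinearMap
  have hev (B : Subalgebra.centralizer ℝ {A}) : ev B = (B : Matrix _ _ ℝ).mulVec v' := rfl
  have hinj : Function.Injective ev := by
    rw [injective_iff_map_eq_zero]
    intro B hB
    rw [hev] at hB
    refine Subtype.ext (Matrix.toLin'.injective ?_)
    ext1 w
    ext1
    obtain ⟨p, hp⟩ := hspan (Pi.single w 1)
    have hc : Commute (B : Matrix (Fin n) (Fin n) ℝ) (aeval A p) :=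
      Algebra.commute_of_mem_adjoin_singleton_of_commute (aeval_mem_adjoin_singleton ℝ A)
        (mem_centralizer_singleton_iff.1 B.2).symm
    have h1 : (B : Matrix (Fin n) (Fin n) ℝ).mulVec (Pi.single w 1) = 0 := by
      rw [← hp, Matrix.mulVec_mulVec, hc.eq, ← Matrix.mulVec_mulVec, hB, Matrix.mulVec_zero]
    simpa using h1
  have := LinearMap.finrank_le_finrank_of_injective hinj
  rwa [Module.finrank_fin_fun] at this

end Matrix

/-! ### Characteristic polynomials with simple imaginary roots -/

section FreqPoly

variable {n m : ℕ} {θ : Fin m → ℝ}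

theorem irreducible_X_sq_add_C {w : ℝ} (hw : w ≠ 0) : Irreducible (X ^ 2 + C (w ^ 2) : ℝ[X]) := by
  have hmon : (X ^ 2 + C (w ^ 2) : ℝ[X]).Monic := monic_X_pow_add_C _ two_ne_zero
  have hdeg : (X ^ 2 + C (w ^ 2) : ℝ[X]).natDegree = 2 := natDegree_X_pow_add_C
  rw [hmon.irreducible_iff_roots_eq_zero_of_degree_le_three (by rw [hdeg]) (by rw [hdeg]; norm_num),
    Multiset.eq_zero_iff_forall_notMem]
  intro x hx
  have h1 := (mem_roots hmon.ne_zero).1 hx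
  have h2 : x ^ 2 + w ^ 2 = 0 := by simpa using h1
  have : 0 < w ^ 2 := by positivity
  nlinarith [sq_nonneg x]

theorem natDegree_prod_sq_add (θ : Fin m → ℝ) :
    (∏ j, (X ^ 2 + C (θ j ^ 2) : ℝ[X])).natDegree = 2 * m := by
  rw [natDegree_prod_of_monic _ _ fun j _ => monic_X_pow_add_C _ two_ne_zero,
    Finset.sum_congr rfl fun j _ => natDegree_X_pow_add_C]
  simp [mul_comm]

theorem monic_prod_sq_add (θ : Fin m → ℝ) : (∏ j, (X ^ 2 + C (θ j ^ 2) : ℝ[X])).Monic :=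
  monic_prod_of_monic _ _ fun _ _ => monic_X_pow_add_C _ two_ne_zero

/-- The characteristic polynomial of a real matrix of size `n ∈ {2m, 2m + 1}` with
`m` distinct pairs of imaginary eigenvalues. -/
noncomputable def freqPoly (n : ℕ) (θ : Fin m → ℝ) : ℝ[X] :=
  if n = 2 * m then ∏ j, (X ^ 2 + C (θ j ^ 2)) else imagPoly θ

theorem freqPoly_dvd_imagPoly (n : ℕ) (θ : Fin m → ℝ) : freqPoly n θ ∣ imagPoly θ := by
  rw [freqPoly]
  split_ifs
  · rw [imagPoly_eq_prod]; exact dvd_mul_right _ _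
  · exact dvd_rfl

theorem freqPoly_monic (n : ℕ) (θ : Fin m → ℝ) : (freqPoly n θ).Monic := by
  rw [freqPoly]
  split_ifs
  · exact monic_prod_sq_add θ
  · rw [imagPoly_eq_prod]; exact (monic_prod_sq_add θ).mul monic_X

theorem natDegree_freqPoly (h : 2 * m ≤ n) (h' : n ≤ 2 * m + 1) (θ : Fin m → ℝ) :
    (freqPoly n θ).natDegree = n := by
  rw [freqPoly]
  split_ifs with hn
  · rw [natDegree_prod_sq_add, hn]
  · rw [imagPoly_eq_prod, (monic_prod_sq_add θ).natDegree_mul monic_X, natDegree_prod_sq_add,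
      natDegree_X]
    omega

theorem nodup_roots_map_freqPoly (n : ℕ) (hθ : StrictMono θ) (h0 : ∀ j, 0 < θ j) :
    ((freqPoly n θ).map (algebraMap ℝ ℂ)).roots.Nodup :=
  nodup_roots (((imagPoly_separable hθ h0).of_dvd (freqPoly_dvd_imagPoly n θ)).map)

/-- The frequencies `1, …, m`. -/
def stdFreq (m : ℕ) : Fin m → ℝ := fun j => (j : ℝ) + 1

theorem stdFreq_strictMono (m : ℕ) : StrictMono (stdFreq m) := by
  intro i j hij
  simpa [stdFreq] using hij

theorem stdFreq_pos (m : ℕ) (j : Fin m) : 0 < stdFreq m j := by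
  simp only [stdFreq]; positivity

theorem imagPoly_stdFreq_dvd (h : m ≤ n) : imagPoly (stdFreq m) ∣ imagPoly (stdFreq n) := by
  rw [imagPoly_eq_prod, imagPoly_eq_prod]
  refine mul_dvd_mul_right ?_ X
  have h1 (k : ℕ) : ∏ j, (X ^ 2 + C (stdFreq k j ^ 2) : ℝ[X]) =
      ∏ j ∈ Finset.range k, (X ^ 2 + C (((j : ℝ) + 1) ^ 2)) :=
    Fin.prod_univ_eq_prod_range (fun j => (X ^ 2 + C (((j : ℝ) + 1) ^ 2) : ℝ[X])) k
  rw [h1, h1]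
  exact Finset.prod_dvd_prod_of_subset _ _ _ (Finset.range_subset_range.2 h)

end FreqPoly

/-! ### Simple spectrum and the top stratum -/

namespace ImagFrame

variable {n m : ℕ} {θ : Fin m → ℝ} (fr : ImagFrame (Matrix (Fin n) (Fin n) ℝ) m)

/-- An irreducible factor `X ^ 2 + θ j ^ 2` not dividing the minimal polynomial would be coprime to
it, so its value at the point would be invertible, against `isUnit_point_sq_add_iff`. -/
theorem prod_dvd_minpoly (hθ : StrictMono θ) (h0 : ∀ j, 0 < θ j) :
    ∏ j, (X ^ 2 + C (θ j ^ 2)) ∣ minpoly ℝ (fr.point θ) := by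
  refine Finset.prod_dvd_of_coprime ((pairwise_isCoprime_sq_add hθ h0).set_pairwise _) fun j _ => ?_
  by_contra h
  have h1 := ((irreducible_X_sq_add_C (h0 j).ne').coprime_iff_not_dvd.2 h).symm
  have h2 : IsNilpotent (aeval (fr.point θ) (minpoly ℝ (fr.point θ))) := by
    rw [minpoly.aeval]; exact IsNilpotent.zero
  have h3 := isUnit_aeval_of_isCoprime h2 h1
  refine (fr.isUnit_point_sq_add_iff θ (h0 j) h0).1 ?_ ⟨j, rfl⟩
  simpa using h3

theorem two_mul_le (fr : ImagFrame (Matrix (Fin n) (Fin n) ℝ) m) : 2 * m ≤ n := by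
  have h1 := (fr.prod_dvd_minpoly (stdFreq_strictMono m) (stdFreq_pos m)).trans
    (Matrix.minpoly_dvd_charpoly _)
  have h2 := natDegree_le_of_dvd h1 (Matrix.charpoly_monic _).ne_zero
  rwa [natDegree_prod_sq_add, Matrix.charpoly_natDegree_eq_dim, Fintype.card_fin] at h2

theorem freqPoly_dvd_minpoly (hθ : StrictMono θ) (h0 : ∀ j, 0 < θ j) (hn : n ≤ 2 * m + 1) :
    freqPoly n θ ∣ minpoly ℝ (fr.point θ) := by
  have hg := fr.prod_dvd_minpoly hθ h0
  rw [freqPoly]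
  split_ifs with h
  · exact hg
  have hn' : n = 2 * m + 1 := le_antisymm hn (by have := fr.two_mul_le; omega)
  set A := fr.point θ
  set g := ∏ j, (X ^ 2 + C (θ j ^ 2) : ℝ[X]) with hgdef
  have hgm : g.Monic := monic_prod_sq_add θ
  -- For odd `n` the cofactor `q` is linear. Its root is a real eigenvalue with zero real part,
  -- hence `0`; the matrix is singular and `X` divides the minimal polynomial too.
  obtain ⟨q, hq⟩ := hg.trans (Matrix.minpoly_dvd_charpoly A)
  have hqm : q.Monic := hgm.of_mul_monic_left (hq ▸ Matrix.charpoly_monic A)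
  have hqd : q.natDegree = 1 := by
    have h1 := congrArg natDegree hq
    rw [Matrix.charpoly_natDegree_eq_dim, Fintype.card_fin, hgm.natDegree_mul hqm, hgdef,
      natDegree_prod_sq_add] at h1
    omega
  have hq0 : q.coeff 0 = 0 := by
    have h1 := fr.hasPurelyImaginarySpectrum_of_mem (fr.point_mem_stratum hθ h0)
    rw [hasPurelyImaginarySpectrum_iff] at h1
    have h2 := h1 (-(q.coeff 0 : ℂ)) (by
      rw [Matrix.charpoly_map, IsRoot, eval_map_algebraMap, hq, map_mul,
        hqm.eq_X_add_C hqd]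
      simp)
    simpa using h2
  have hX : X ∣ minpoly ℝ A := by
    by_contra hX
    have h2 : IsNilpotent (aeval A (minpoly ℝ A)) := by
      rw [minpoly.aeval]; exact IsNilpotent.zero
    have h3 := isUnit_aeval_of_isCoprime h2 ((irreducible_X).coprime_iff_not_dvd.2 hX).symm
    rw [aeval_X] at h3
    have h4 := (Matrix.isUnit_iff_isUnit_det _).1 h3.neg
    have h5 : (-A).det = A.charpoly.eval 0 := by rw [Matrix.eval_charpoly]; simp
    rw [h5, hq, hqm.eq_X_add_C hqd, hq0] at h4
    simp at h4
  rw [imagPoly_eq_prod]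
  exact (isCoprime_prod_sq_add_X h0).mul_dvd hg hX

theorem minpoly_point (hθ : StrictMono θ) (h0 : ∀ j, 0 < θ j) (hn : n ≤ 2 * m + 1) :
    minpoly ℝ (fr.point θ) = freqPoly n θ := by
  refine eq_of_monic_of_dvd_of_natDegree_le (freqPoly_monic n θ)
    (minpoly.monic (Algebra.IsIntegral.isIntegral _)) (fr.freqPoly_dvd_minpoly hθ h0 hn) ?_
  rw [natDegree_freqPoly fr.two_mul_le hn]
  have := natDegree_le_of_dvd (Matrix.minpoly_dvd_charpoly (fr.point θ))
    (Matrix.charpoly_monic _).ne_zero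
  rwa [Matrix.charpoly_natDegree_eq_dim, Fintype.card_fin] at this

theorem charpoly_point (hθ : StrictMono θ) (h0 : ∀ j, 0 < θ j) (hn : n ≤ 2 * m + 1) :
    (fr.point θ).charpoly = freqPoly n θ := by
  refine eq_of_monic_of_dvd_of_natDegree_le (freqPoly_monic n θ) (Matrix.charpoly_monic _)
    ((fr.freqPoly_dvd_minpoly hθ h0 hn).trans (Matrix.minpoly_dvd_charpoly _)) ?_
  rw [natDegree_freqPoly fr.two_mul_le hn, Matrix.charpoly_natDegree_eq_dim, Fintype.card_fin]

/-- The only possible eigenvalues are `0` and `± i θ j`, at most `2 * m + 1` values for `n` roots.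
Conversely, under the bound the characteristic polynomial is `freqPoly n θ`, which is separable. -/
theorem hasNoRepeatedEigenvalues_iff {A : Matrix (Fin n) (Fin n) ℝ} (hA : A ∈ fr.stratum) :
    HasNoRepeatedEigenvalues A ↔ n ≤ 2 * m + 1 := by
  obtain ⟨θ, hθ, h0, C, rfl⟩ := hA
  rw [← conjEquiv_apply, ← map_point]
  generalize fr.map (conjEquiv C) = fr
  constructor
  · intro h
    rw [HasNoRepeatedEigenvalues, complexify] at h
    set χ := ((fr.point θ).map (algebraMap ℝ ℂ)).charpoly with hχ
    have hcard : χ.roots.card = n := by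
      rw [← (IsAlgClosed.splits χ).natDegree_eq_card_roots, hχ, Matrix.charpoly_natDegree_eq_dim,
        Fintype.card_fin]
    let s : Finset ℂ := insert 0 (Finset.univ.image (fun j => (θ j : ℂ) * Complex.I) ∪
      Finset.univ.image fun j => -((θ j : ℂ) * Complex.I))
    have hs : χ.roots.toFinset ⊆ s := by
      intro z hz
      rw [Multiset.mem_toFinset, mem_roots (Matrix.charpoly_monic _).ne_zero] at hz
      have h1 := Matrix.aeval_eq_zero_of_isRoot_charpoly_map (fr.isNilpotent_aeval_point θ) hz
      rw [aeval_complex_imagPoly_eq_zero_iff] at h1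
      simp only [s, Finset.mem_insert, Finset.mem_union, Finset.mem_image, Finset.mem_univ,
        true_and]
      refine h1.imp_right ?_
      rintro ⟨j, hj⟩
      have h1 : (z - θ j * Complex.I) * (z + θ j * Complex.I) = 0 := by
        rw [← hj]; linear_combination -(θ j : ℂ) ^ 2 * Complex.I_sq
      rcases mul_eq_zero.1 h1 with h | h
      · exact Or.inl ⟨j, (sub_eq_zero.1 h).symm⟩
      · exact Or.inr ⟨j, (eq_neg_of_add_eq_zero_left h).symm⟩
    have h1 : s.card ≤ 2 * m + 1 := by
      refine (Finset.card_insert_le _ _).trans (Nat.add_le_add_right ?_ 1)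
      refine (Finset.card_union_le _ _).trans ?_
      rw [two_mul]
      exact Nat.add_le_add (Finset.card_image_le.trans (by simp))
        (Finset.card_image_le.trans (by simp))
    rw [← hcard, ← Multiset.toFinset_card_of_nodup h]
    exact (Finset.card_le_card hs).trans h1
  · intro h
    rw [HasNoRepeatedEigenvalues, complexify, Matrix.charpoly_map, fr.charpoly_point hθ h0 h]
    exact nodup_roots_map_freqPoly n hθ h0

theorem le_finrank_centralizer_frame : n ≤ Module.finrank ℝ fr.centralizer := by
  rw [← fr.centralizer_point (stdFreq_strictMono m) (stdFreq_pos m)]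
  exact Matrix.le_finrank_centralizer _

theorem finrank_centralizer_of_le (hn : n ≤ 2 * m + 1) :
    Module.finrank ℝ fr.centralizer = n := by
  rw [← fr.centralizer_point (stdFreq_strictMono m) (stdFreq_pos m)]
  refine Matrix.finrank_centralizer_of_cyclic ?_
  rw [fr.minpoly_point (stdFreq_strictMono m) (stdFreq_pos m) hn,
    natDegree_freqPoly fr.two_mul_le hn]

/-- All elements with purely imaginary simple spectrum lie in the same stratum. -/
theorem stratum_eq_of_le {m' : ℕ} (fr' : ImagFrame (Matrix (Fin n) (Fin n) ℝ) m')
    (hn : n ≤ 2 * m + 1) (hn' : n ≤ 2 * m' + 1) : fr.stratum = fr'.stratum := by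
  obtain rfl : m = m' := by have := fr.two_mul_le; have := fr'.two_mul_le; omega
  have hθ := stdFreq_strictMono m
  have h0 := stdFreq_pos m
  obtain ⟨C, hC⟩ := Matrix.exists_conj_of_minpoly_eq (A := fr.point (stdFreq m))
    (B := fr'.point (stdFreq m))
    (by rw [fr.minpoly_point hθ h0 hn, natDegree_freqPoly fr.two_mul_le hn])
    (by rw [fr.minpoly_point hθ h0 hn, fr'.minpoly_point hθ h0 hn])
  exact (exists_eq_of_mem_stratum ⟨_, hθ, h0, C, hC⟩ (fr'.point_mem_stratum hθ h0)).2

/-- Moving the frequencies to `1, …, m` with `m ≤ n` stays in the stratum and makes the annihilating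
polynomial depend on `n` only. This is what makes the number of strata finite. -/
theorem exists_mem_stratum_aeval_eq_zero :
    ∃ A ∈ fr.stratum, aeval A (imagPoly (stdFreq n) ^ n) = 0 := by
  have hmn : m ≤ n := by have := fr.two_mul_le; omega
  refine ⟨_, fr.point_mem_stratum (stdFreq_strictMono m) (stdFreq_pos m), ?_⟩
  have h := Matrix.aeval_pow_card_eq_zero (M := fr.point (stdFreq m)) (p := imagPoly (stdFreq m))
    fun z hz => Matrix.aeval_eq_zero_of_isRoot_charpoly_map (fr.isNilpotent_aeval_point _) hz
  rw [Fintype.card_fin, ← map_pow] at h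
  obtain ⟨q, hq⟩ := pow_dvd_pow_of_dvd (imagPoly_stdFreq_dvd hmn) n
  rw [hq, map_mul, h, zero_mul]

end ImagFrame

/-! ### Existence of simple spectrum, finiteness of the strata, and the theorem -/

section Main

variable {n : ℕ}

/-- A companion matrix: multiplication by the adjoined root on `ℝ[X]/(p)`. -/
theorem exists_matrix_charpoly_eq {p : ℝ[X]} (hp : p.Monic) (hn : p.natDegree = n) :
    ∃ A : Matrix (Fin n) (Fin n) ℝ, A.charpoly = p := by
  let pb := AdjoinRoot.powerBasis hp.ne_zero
  have h : ∃ A : Matrix (Fin pb.dim) (Fin pb.dim) ℝ, A.charpoly = p :=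
    ⟨_, (charpoly_leftMulMatrix pb).trans (AdjoinRoot.minpoly_powerBasis_gen_of_monic hp)⟩
  rwa [AdjoinRoot.powerBasis_dim, hn] at h

theorem exists_hasNoRepeatedEigenvalues (n : ℕ) :
    ∃ A : Matrix (Fin n) (Fin n) ℝ,
      HasPurelyImaginarySpectrum A ∧ HasNoRepeatedEigenvalues A := by
  obtain ⟨A, hA⟩ := exists_matrix_charpoly_eq (freqPoly_monic n (stdFreq (n / 2)))
    (natDegree_freqPoly (by omega) (by omega) _)
  refine ⟨A, ?_, ?_⟩
  · rw [hasPurelyImaginarySpectrum_iff]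
    intro z hz
    rw [Matrix.charpoly_map, hA, IsRoot, eval_map_algebraMap] at hz
    refine re_eq_zero_of_aeval_imagPoly (θ := stdFreq (n / 2)) ?_
    obtain ⟨q, hq⟩ := freqPoly_dvd_imagPoly n (stdFreq (n / 2))
    rw [hq, map_mul, hz, zero_mul]
  · rw [HasNoRepeatedEigenvalues, complexify, Matrix.charpoly_map, hA]
    exact nodup_roots_map_freqPoly n (stdFreq_strictMono _) (stdFreq_pos _)

/-- The collection of all the strata. -/
def strata (n : ℕ) : Set (Set (Matrix (Fin n) (Fin n) ℝ)) :=
  {M | ∃ (m : ℕ) (fr : ImagFrame (Matrix (Fin n) (Fin n) ℝ) m), M = fr.stratum}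

theorem eq_of_mem_strata {M M' : Set (Matrix (Fin n) (Fin n) ℝ)} (hM : M ∈ strata n)
    (hM' : M' ∈ strata n) {A : Matrix (Fin n) (Fin n) ℝ} (h : A ∈ M) (h' : A ∈ M') : M = M' := by
  obtain ⟨m, fr, rfl⟩ := hM
  obtain ⟨m', fr', rfl⟩ := hM'
  exact (ImagFrame.exists_eq_of_mem_stratum h h').2

theorem finite_strata (n : ℕ) : (strata n).Finite := by
  have hF : imagPoly (stdFreq n) ^ n ≠ 0 :=
    pow_ne_zero _ (imagPoly_separable (stdFreq_strictMono n) (stdFreq_pos n)).ne_zero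
  obtain ⟨T, hT, hTA⟩ := Matrix.exists_finite_conj_representatives (n := n) hF
  have hex (M : Set (Matrix (Fin n) (Fin n) ℝ)) (hM : M ∈ strata n) : ∃ A ∈ T, A ∈ M := by
    obtain ⟨m, fr, rfl⟩ := hM
    obtain ⟨A, hA, hAF⟩ := fr.exists_mem_stratum_aeval_eq_zero
    obtain ⟨C, hC⟩ := hTA A hAF
    exact ⟨_, hC, fr.conj_mem_stratum hA C⟩
  choose! f hfT hf using hex
  refine Set.Finite.of_injOn (f := f) (t := T) hfT (fun M hM M' hM' h => ?_) hT
  exact eq_of_mem_strata hM hM' (hf M hM) (h ▸ hf M' hM')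

theorem ceil_natCast_div_two (n : ℕ) : ⌈(n : ℚ) / 2⌉ = (n : ℤ) - (n / 2 : ℕ) := by
  rw [Int.ceil_eq_iff]
  obtain ⟨k, rfl | rfl⟩ := n.even_or_odd'
  · rw [Nat.mul_div_cancel_left k two_pos]
    push_cast
    constructor <;> linarith
  · have : (2 * k + 1) / 2 = k := by omega
    rw [this]
    push_cast
    constructor <;> linarith

end Main

theorem theorem7p9 (n : ℕ) :
    ∃ (k : ℕ) (M : Fin k → Set (Matrix (Fin n) (Fin n) ℝ)) (d : Fin k → ℕ),
      (⋃ i, M i) = {A | HasPurelyImaginarySpectrum A} ∧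
      Pairwise (fun i j => Disjoint (M i) (M j)) ∧
      (∀ i, (M i).Nonempty ∧ IsConjugacyInvariant (M i) ∧ IsEmbeddedSubmanifold (d i) (M i)) ∧
      ∃ i₀, (d i₀ : ℤ) = (n : ℤ) ^ 2 - ⌈(n : ℚ) / 2⌉ ∧
        (∀ i, i ≠ i₀ → (d i : ℤ) < (n : ℤ) ^ 2 - ⌈(n : ℚ) / 2⌉) ∧
        M i₀ = {A | HasPurelyImaginarySpectrum A ∧ HasNoRepeatedEigenvalues A} := by
  have := (finite_strata n).to_subtype
  let e : Fin (Nat.card (strata n)) ≃ strata n := (Finite.equivFin (strata n)).symm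
  choose m fr hfr using fun i => (e i).2
  have hunion {A : Matrix (Fin n) (Fin n) ℝ} (hA : HasPurelyImaginarySpectrum A) :
      ∃ i, A ∈ (fr i).stratum := by
    obtain ⟨m', fr', hfr'⟩ := exists_frame_of_hasPurelyImaginarySpectrum hA
    refine ⟨e.symm ⟨fr'.stratum, m', fr', rfl⟩, ?_⟩
    rw [← hfr, e.apply_symm_apply]
    exact hfr'
  have hinj {i j} (h : (fr i).stratum = (fr j).stratum) : i = j :=
    e.injective (Subtype.ext (by rw [hfr i, hfr j, h]))
  -- Ensures that the truncated subtraction in the dimension formula is a true one.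
  have hcent (i) : Module.finrank ℝ (fr i).centralizer ≤ n ^ 2 := by
    refine (Submodule.finrank_le (Subalgebra.toSubmodule (fr i).centralizer)).trans ?_
    rw [Module.finrank_matrix]
    simp [sq]
  obtain ⟨A₀, hA₀, hA₀'⟩ := exists_hasNoRepeatedEigenvalues n
  obtain ⟨i₀, hi₀⟩ := hunion hA₀
  have hn₀ := ((fr i₀).hasNoRepeatedEigenvalues_iff hi₀).1 hA₀'
  refine ⟨_, fun i => (fr i).stratum,
    fun i => n ^ 2 - Module.finrank ℝ (fr i).centralizer + m i, ?_, ?_, fun i => ⟨?_, ?_, ?_⟩, i₀,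
    ?_, ?_, ?_⟩
  · ext A
    rw [Set.mem_iUnion]
    exact ⟨fun ⟨i, hi⟩ => (fr i).hasPurelyImaginarySpectrum_of_mem hi, hunion⟩
  · intro i j hij
    refine Set.disjoint_left.2 fun A hA hA' => hij (hinj ?_)
    exact (ImagFrame.exists_eq_of_mem_stratum hA hA').2
  · exact ⟨_, (fr i).point_mem_stratum (stdFreq_strictMono _) (stdFreq_pos _)⟩
  · exact fun A hA C => (fr i).conj_mem_stratum hA C
  · exact (fr i).isEmbeddedSubmanifold_stratum_matrix
  · have h1 := hcent i₀
    have h2 := (fr i₀).two_mul_le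
    beta_reduce
    rw [(fr i₀).finrank_centralizer_of_le hn₀] at h1 ⊢
    rw [ceil_natCast_div_two]
    push_cast [Nat.cast_sub h1]
    omega
  · intro i hi
    have h1 := hcent i
    have h2 := (fr i).two_mul_le
    have h3 := (fr i).le_finrank_centralizer_frame
    -- Two strata with simple spectrum would coincide, so any other one has `2 * m + 2 ≤ n`;
    -- together with a centralizer of dimension at least `n` this gives the strict inequality.
    have h4 : ¬ n ≤ 2 * m i + 1 := fun h => hi (hinj ((fr i).stratum_eq_of_le (fr i₀) h hn₀))
    rw [ceil_natCast_div_two]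
    push_cast [Nat.cast_sub h1]
    omega
  · ext A
    constructor
    · exact fun hA => ⟨(fr i₀).hasPurelyImaginarySpectrum_of_mem hA,
        ((fr i₀).hasNoRepeatedEigenvalues_iff hA).2 hn₀⟩
    · rintro ⟨hA, hA'⟩
      obtain ⟨i, hi⟩ := hunion hA
      have h := (fr i).stratum_eq_of_le (fr i₀) (((fr i).hasNoRepeatedEigenvalues_iff hi).1 hA') hn₀
      exact Set.mem_of_mem_of_subset hi h.subset
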